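/- Let $(Y,\Omega)$ be a closed (compact, without boundary) connected symplectic manifold, and let $G$ be its group of Hamiltonian diffeomorphisms, i.e. of all symplectomorphisms which can be included into a time-dependent Hamiltonian flow on $Y$. Write $S^1=\mathbb R/\mathbb Z$. A smooth loop $h\colon S^1\to G$ is a family $h(t)\in G$ such that $(t,y)\mapsto h(t)y$ is smooth and which is generated by a Hamiltonian function $H\colon S^1\times Y\to\mathbb R$, i.e. $H$ is smooth and $\frac{d}{dt}h(t)y=X_t(h(t)y)$ with $\Omega(X_t,\cdot)=dH(t,\cdot)$; the function $H$ is normalized (and thereby unique) by $\int_Y H(t,\cdot)\,\Omega^n=0$ for all $t$, where $2n=\dim Y$. The loop need not pass through the identity; it represents an element of $\pi_1(G)$ through its free homotopy class. Homotopies of loops are understood to be smooth. Its length is $$\operatorname{length}(h)=\int_0^1\max_{y\in Y}|H(t,y)|\,dt .$$ For $\gamma\in\pi_1(G)$ put $\|\gamma\|=\inf\operatorname{length}(h)$, where $h$ runs over all smooth loops representing $\gamma$. A homeomorphism of a compact topological space is strictly ergodic if it has precisely one invariant Borel probability measure and this measure is positive on non-empty open subsets. A smooth loop $h$ is strictly ergodic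 if for some irrational $\alpha$ the skew product $T(t,y)=(t+\alpha,h(t)y)$ of $S^1\times Y$ is strictly ergodic. **Theorem 1.3.A.** Let $\gamma\in\pi_1(G)$ be a class represented by a smooth strictly ergodic loop. Then the asymptotic Hofer norm of $\gamma$ vanishes: $$\|\gamma\|_\infty=\lim_{k\to\infty}\frac1k\|\gamma^k\|=0 .$$ -/

import Mathlib

open scoped Manifold ContDiff Topology
open MeasureTheory

noncomputable section

/-! ### Strictly ergodic maps -/

/-- A self-map of a topological space carrying its Borel σ-algebra is strictly ergodic if it has
exactly one invariant probability measure, and this measure is positive on non-empty open sets. -/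
def StrictlyErgodic {X : Type*} [TopologicalSpace X] [MeasurableSpace X] (T : X → X) : Prop :=
  ∃ μ : Measure X, IsProbabilityMeasure μ ∧ MeasurePreserving T μ μ ∧
    (∀ ν : Measure X, IsProbabilityMeasure ν → MeasurePreserving T ν ν → ν = μ) ∧
    ∀ U : Set X, IsOpen U → U.Nonempty → 0 < μ U

/-! ### Symplectic forms

Manifolds are modelled on `ℝ²ⁿ` and have no boundary. -/

/-- The model space `ℝ²ⁿ`. -/
abbrev R2n (n : ℕ) : Type := EuclideanSpace ℝ (Fin (2 * n))

/-- A field of alternating bilinear forms on the tangent spaces of `M`. -/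
abbrev TwoForm (n : ℕ) (M : Type*) [TopologicalSpace M] [ChartedSpace (R2n n) M] : Type _ :=
  ∀ x : M, (TangentSpace 𝓘(ℝ, R2n n) x) [⋀^Fin 2]→L[ℝ] ℝ

/-- The expression of a 2-form in the preferred chart at `x₀`: its pull-back under the inverse of
that chart, a 2-form on `ℝ²ⁿ` (meaningful on the target of the chart). -/
def TwoForm.inChart {n : ℕ} {M : Type*} [TopologicalSpace M] [ChartedSpace (R2n n) M]
    (w : TwoForm n M) (x₀ : M) (z : R2n n) : (R2n n) [⋀^Fin 2]→L[ℝ] ℝ :=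
  (w ((extChartAt 𝓘(ℝ, R2n n) x₀).symm z)).compContinuousLinearMap
    (mfderiv 𝓘(ℝ, R2n n) 𝓘(ℝ, R2n n) (extChartAt 𝓘(ℝ, R2n n) x₀).symm z)

/-- A symplectic form: a smooth, closed, non-degenerate 2-form. -/
structure SymplecticForm (n : ℕ) (M : Type*) [TopologicalSpace M] [ChartedSpace (R2n n) M] where
  form : TwoForm n M
  smooth : ∀ x₀ : M,
    ContDiffOn ℝ ∞ (TwoForm.inChart form x₀) (extChartAt 𝓘(ℝ, R2n n) x₀).target
  closed : ∀ x₀ : M, ∀ z ∈ (extChartAt 𝓘(ℝ, R2n n) x₀).target,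
    extDeriv (TwoForm.inChart form x₀) z = 0
  nondegenerate : ∀ (x : M) (u : TangentSpace 𝓘(ℝ, R2n n) x),
    (∀ v : TangentSpace 𝓘(ℝ, R2n n) x, form x ![u, v] = 0) → u = 0

namespace SymplecticForm

variable {n : ℕ} {M : Type*} [TopologicalSpace M] [ChartedSpace (R2n n) M]

/-- The density `√(det (Ω(eᵢ, eⱼ)))` of the volume form `Ωⁿ / n!` with respect to Lebesgue measure
in the chart at `x₀`. -/
def chartDensity (Ω : SymplecticForm n M) (x₀ : M) (z : R2n n) : ℝ :=
  Real.sqrt (Matrix.det (Matrix.of fun i j : Fin (2 * n) =>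
    TwoForm.inChart Ω.form x₀ z ![EuclideanSpace.single i 1, EuclideanSpace.single j 1]))

/-- The symplectic volume measure on the domain of the chart at `x₀`, extended by zero. -/
def chartVolume [MeasurableSpace M] (Ω : SymplecticForm n M) (x₀ : M) : Measure M :=
  (((volume : Measure (R2n n)).restrict (extChartAt 𝓘(ℝ, R2n n) x₀).target).withDensity
    fun z => ENNReal.ofReal (Ω.chartDensity x₀ z)).map (extChartAt 𝓘(ℝ, R2n n) x₀).symm

/-- The symplectic volume measure of `(M, Ω)`, given by the volume form `Ωⁿ / n!`.  The measures
`chartVolume x₀` are its restrictions to the chart domains, so it is their least upper bound. -/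
def volumeMeasure [MeasurableSpace M] (Ω : SymplecticForm n M) : Measure M :=
  ⨆ x₀ : M, Ω.chartVolume x₀

/-! ### Hamiltonian diffeomorphisms -/

/-- `φ` is a symplectomorphism: `φ^* Ω = Ω`. -/
def IsSymplecto (Ω : SymplecticForm n M) (φ : M ≃ₘ⟮𝓘(ℝ, R2n n), 𝓘(ℝ, R2n n)⟯ M) : Prop :=
  ∀ x : M, (Ω.form (φ x)).compContinuousLinearMap
    (mfderiv 𝓘(ℝ, R2n n) 𝓘(ℝ, R2n n) φ x) = Ω.form x

/-- A smooth one-parameter family of diffeomorphisms of `M` (a smooth isotopy): its track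
`(t, y) ↦ (t, φ t y)` is a diffeomorphism of `ℝ × M`. -/
def IsSmoothFamily (φ : ℝ → (M ≃ₘ⟮𝓘(ℝ, R2n n), 𝓘(ℝ, R2n n)⟯ M)) : Prop :=
  ContMDiff (𝓘(ℝ, ℝ).prod 𝓘(ℝ, R2n n)) 𝓘(ℝ, R2n n) ∞ (fun p : ℝ × M => φ p.1 p.2) ∧
  ContMDiff (𝓘(ℝ, ℝ).prod 𝓘(ℝ, R2n n)) 𝓘(ℝ, R2n n) ∞ (fun p : ℝ × M => (φ p.1).symm p.2)

/-- The velocity `(d/dt) φ t y`, a tangent vector at `φ t y`. -/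
def velocity (φ : ℝ → (M ≃ₘ⟮𝓘(ℝ, R2n n), 𝓘(ℝ, R2n n)⟯ M)) (t : ℝ) (y : M) :
    TangentSpace 𝓘(ℝ, R2n n) (φ t y) :=
  mfderiv 𝓘(ℝ, ℝ) 𝓘(ℝ, R2n n) (fun s : ℝ => φ s y) t (1 : ℝ)

/-- The smooth time-dependent Hamiltonian function `H` generates the family `φ`: we have
`(d/dt) φ t = X_t ∘ φ t`, where `Ω(X_t, ·) = d(H t)`. -/
def Generates (Ω : SymplecticForm n M) (H : ℝ → M → ℝ)
    (φ : ℝ → (M ≃ₘ⟮𝓘(ℝ, R2n n), 𝓘(ℝ, R2n n)⟯ M)) : Prop :=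
  ContMDiff (𝓘(ℝ, ℝ).prod 𝓘(ℝ, R2n n)) 𝓘(ℝ, ℝ) ∞ (fun p : ℝ × M => H p.1 p.2) ∧
  ∀ (t : ℝ) (y : M) (v : TangentSpace 𝓘(ℝ, R2n n) (φ t y)),
    Ω.form (φ t y) ![velocity φ t y, v] = mfderiv 𝓘(ℝ, R2n n) 𝓘(ℝ, ℝ) (H t) (φ t y) v

/-- The group of Hamiltonian diffeomorphisms of `(M, Ω)`, as a set: the symplectomorphisms which
can be included into a time-dependent Hamiltonian flow. -/
def Ham (Ω : SymplecticForm n M) : Set (M ≃ₘ⟮𝓘(ℝ, R2n n), 𝓘(ℝ, R2n n)⟯ M) :=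
  {φ | Ω.IsSymplecto φ ∧
    ∃ (ψ : ℝ → (M ≃ₘ⟮𝓘(ℝ, R2n n), 𝓘(ℝ, R2n n)⟯ M)) (H : ℝ → M → ℝ),
      IsSmoothFamily ψ ∧ Ω.Generates H ψ ∧ (∀ y, ψ 0 y = y) ∧ ψ 1 = φ}

/-- `H : S¹ × M → ℝ` (a function that is 1-periodic in time) is a normalized Hamiltonian of the
family `φ`: it generates `φ`, and `H t` has zero mean for all `t`. -/
def IsNormalizedHamiltonian [MeasurableSpace M] (Ω : SymplecticForm n M) (H : ℝ → M → ℝ)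
    (φ : ℝ → (M ≃ₘ⟮𝓘(ℝ, R2n n), 𝓘(ℝ, R2n n)⟯ M)) : Prop :=
  Ω.Generates H φ ∧ Function.Periodic H 1 ∧ ∀ t : ℝ, ∫ y, H t y ∂Ω.volumeMeasure = 0

end SymplecticForm

/-! ### Loops of Hamiltonian diffeomorphisms

The circle is `S¹ = ℝ/ℤ`; a map from it is a 1-periodic map on `ℝ`. -/

/-- A smooth loop `S¹ → Ham(M, Ω)`: a smooth family of Hamiltonian diffeomorphisms, periodic in
time and generated by a normalized Hamiltonian function (that is, its velocity at each time lies in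
the Lie algebra of `Ham(M, Ω)`).  The loop need not pass through the identity. -/
structure HamLoop {n : ℕ} {M : Type*} [TopologicalSpace M] [ChartedSpace (R2n n) M]
    [MeasurableSpace M] (Ω : SymplecticForm n M) where
  toFun : ℝ → (M ≃ₘ⟮𝓘(ℝ, R2n n), 𝓘(ℝ, R2n n)⟯ M)
  periodic : Function.Periodic toFun 1
  smooth : SymplecticForm.IsSmoothFamily toFun
  mem_ham : ∀ t : ℝ, toFun t ∈ Ω.Ham
  exists_hamiltonian : ∃ H : ℝ → M → ℝ, Ω.IsNormalizedHamiltonian H toFun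

namespace HamLoop

variable {n : ℕ} {M : Type*} [TopologicalSpace M] [ChartedSpace (R2n n) M] [MeasurableSpace M]
  {Ω : SymplecticForm n M}

/-- The skew product `T(t, y) = (t + α, h(t) y)` on `S¹ × M`. -/
def skewProduct (h : HamLoop Ω) (α : ℝ) : UnitAddCircle × M → UnitAddCircle × M :=
  fun p => (p.1 + (α : UnitAddCircle), h.periodic.lift p.1 p.2)

/-- The loop `h` is strictly ergodic: for some irrational `α` its skew product is. -/
def IsStrictlyErgodic (h : HamLoop Ω) : Prop :=
  ∃ α : ℝ, Irrational α ∧ StrictlyErgodic (h.skewProduct α)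

/-- Two smooth loops are smoothly homotopic (as free loops) if they are joined by a family of
smooth loops which is smooth in all variables. -/
def SmoothHomotopic (h₀ h₁ : HamLoop Ω) : Prop :=
  ∃ K : ℝ → HamLoop Ω, K 0 = h₀ ∧ K 1 = h₁ ∧
    ContMDiff (𝓘(ℝ, ℝ).prod (𝓘(ℝ, ℝ).prod 𝓘(ℝ, R2n n))) 𝓘(ℝ, R2n n) ∞
      (fun p : ℝ × ℝ × M => (K p.1).toFun p.2.1 p.2.2)

end HamLoop

namespace SymplecticForm

variable {n : ℕ} {M : Type*} [TopologicalSpace M] [ChartedSpace (R2n n) M]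

theorem comp_toSpanSingleton_one {F : Type*} [AddCommGroup F] [Module ℝ F] [TopologicalSpace F]
    (A : ℝ →L[ℝ] F) (c : ℝ) :
    (A.comp (ContinuousLinearMap.toSpanSingleton ℝ c)) 1 = c • A 1 := by
  rw [← A.map_smul]
  simp

theorem alternating_smul_left {F : Type*} [AddCommGroup F] [Module ℝ F] [TopologicalSpace F]
    (f : F [⋀^Fin 2]→L[ℝ] ℝ) (c : ℝ) (u v : F) : f ![c • u, v] = c * f ![u, v] := by
  have h := f.map_update_smul ![u, v] 0 c u
  have h1 : ∀ w : F, Function.update ![u, v] 0 w = ![w, v] := by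
    intro w
    ext i
    fin_cases i <;> simp
  simpa [h1] using h

theorem IsNormalizedHamiltonian.iterate [MeasurableSpace M] {Ω : SymplecticForm n M}
    {H : ℝ → M → ℝ} {φ : ℝ → (M ≃ₘ⟮𝓘(ℝ, R2n n), 𝓘(ℝ, R2n n)⟯ M)}
    (hφ : IsSmoothFamily φ) (hH : Ω.IsNormalizedHamiltonian H φ) (k : ℕ) :
    Ω.IsNormalizedHamiltonian (fun t y => k * H (k * t) y) (fun t => φ (k * t)) := by
  obtain ⟨⟨hs, hg⟩, hp, hm⟩ := hH
  have hk : ContMDiff (𝓘(ℝ, ℝ).prod 𝓘(ℝ, R2n n)) (𝓘(ℝ, ℝ).prod 𝓘(ℝ, R2n n)) ∞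
      (fun p : ℝ × M => ((k : ℝ) * p.1, p.2)) :=
    (contMDiff_const.mul contMDiff_fst).prodMk contMDiff_snd
  refine ⟨⟨contMDiff_const.mul (hs.comp hk), fun t y v => ?_⟩, fun t => ?_, fun t => ?_⟩
  · have hφy : ContMDiff 𝓘(ℝ, ℝ) 𝓘(ℝ, R2n n) ∞ (fun s : ℝ => φ s y) :=
      hφ.1.comp (contMDiff_id.prodMk contMDiff_const)
    have hv : velocity (fun t => φ (k * t)) t y = (k : ℝ) • velocity φ (k * t) y := by
      have hd : HasDerivAt (fun s : ℝ => (k : ℝ) * s) (k : ℝ) t := by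
        simpa using (hasDerivAt_id t).const_mul (k : ℝ)
      have hc := HasMFDerivAt.comp t
        ((hφy.mdifferentiableAt (x := (k : ℝ) * t) (by simp)).hasMFDerivAt)
        hd.hasFDerivAt.hasMFDerivAt
      have h1 := hc.mfderiv
      have h2 : (fun s : ℝ => φ s y) ∘ (fun s : ℝ => (k : ℝ) * s)
          = fun s : ℝ => φ (k * s) y := rfl
      rw [h2] at h1
      unfold velocity
      rw [h1]
      exact comp_toSpanSingleton_one _ _
    have hH1 : ContMDiff 𝓘(ℝ, R2n n) 𝓘(ℝ, ℝ) ∞ (H (k * t)) :=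
      hs.comp (contMDiff_const.prodMk contMDiff_id)
    have hd : mfderiv 𝓘(ℝ, R2n n) 𝓘(ℝ, ℝ) (fun y => (k : ℝ) * H (k * t) y) (φ (k * t) y)
        = (k : ℝ) • mfderiv 𝓘(ℝ, R2n n) 𝓘(ℝ, ℝ) (H (k * t)) (φ (k * t) y) :=
      const_smul_mfderiv (hH1.mdifferentiableAt (by simp)) (k : ℝ)
    rw [hd, hv]
    exact (alternating_smul_left _ _ _ _).trans
      (congrArg (fun r : ℝ => (k : ℝ) * r) (hg (k * t) y v))
  · have := hp.nat_mul k (k * t)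
    funext y
    have h' := congrFun this y
    simp only [mul_add, mul_one] at h' ⊢
    rw [h']
  · rw [integral_const_mul, hm, mul_zero]

end SymplecticForm

namespace HamLoop

variable {n : ℕ} {M : Type*} [TopologicalSpace M] [ChartedSpace (R2n n) M] [MeasurableSpace M]
  {Ω : SymplecticForm n M}

/-- The loop `h` traversed `k` times, `t ↦ h (k t)`. -/
def iterate (k : ℕ) (h : HamLoop Ω) : HamLoop Ω where
  toFun t := h.toFun (k * t)
  periodic t := by
    have := h.periodic.nat_mul k (k * t)
    simpa [mul_add] using this
  smooth := by
    have hk : ContMDiff (𝓘(ℝ, ℝ).prod 𝓘(ℝ, R2n n)) (𝓘(ℝ, ℝ).prod 𝓘(ℝ, R2n n)) ∞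
        (fun p : ℝ × M => ((k : ℝ) * p.1, p.2)) :=
      (contMDiff_const.mul contMDiff_fst).prodMk contMDiff_snd
    exact ⟨h.smooth.1.comp hk, h.smooth.2.comp hk⟩
  mem_ham t := h.mem_ham _
  exists_hamiltonian :=
    let ⟨_, hH⟩ := h.exists_hamiltonian
    ⟨_, hH.iterate h.smooth k⟩

theorem SmoothHomotopic.iterate {h₀ h₁ : HamLoop Ω} (hh : SmoothHomotopic h₀ h₁) (k : ℕ) :
    SmoothHomotopic (h₀.iterate k) (h₁.iterate k) := by
  obtain ⟨K, rfl, rfl, hK⟩ := hh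
  refine ⟨fun s => (K s).iterate k, rfl, rfl, ?_⟩
  have hk : ContMDiff (𝓘(ℝ, ℝ).prod (𝓘(ℝ, ℝ).prod 𝓘(ℝ, R2n n)))
      (𝓘(ℝ, ℝ).prod (𝓘(ℝ, ℝ).prod 𝓘(ℝ, R2n n))) ∞
      (fun p : ℝ × ℝ × M => (p.1, (k : ℝ) * p.2.1, p.2.2)) :=
    contMDiff_fst.prodMk ((contMDiff_const.mul (contMDiff_fst.comp contMDiff_snd)).prodMk
      (contMDiff_snd.comp contMDiff_snd))
  exact hK.comp hk

end HamLoop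

/-! ### The fundamental group and Hofer's norm -/

/-- The elements of `π₁(Ham(M, Ω))`.  As `Ham(M, Ω)` is a connected topological group, they are the
free homotopy classes of loops; every class is taken through its smooth loops. -/
def HamPi1 {n : ℕ} {M : Type*} [TopologicalSpace M] [ChartedSpace (R2n n) M]
    [MeasurableSpace M] (Ω : SymplecticForm n M) : Type _ :=
  Quot (HamLoop.SmoothHomotopic (Ω := Ω))

namespace HamPi1

variable {n : ℕ} {M : Type*} [TopologicalSpace M] [ChartedSpace (R2n n) M] [MeasurableSpace M]
  {Ω : SymplecticForm n M}

/-- The loop `h` represents the class `γ`. -/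
def IsRepresentedBy (γ : HamPi1 Ω) (h : HamLoop Ω) : Prop :=
  Quot.mk _ h = γ

/-- The power `γ ^ k`: the class of the loops of `γ` traversed `k` times. -/
def npow (γ : HamPi1 Ω) (k : ℕ) : HamPi1 Ω :=
  Quot.map (HamLoop.iterate k) (fun _ _ hh => hh.iterate k) γ

/-- `ℓ` is the length `∫₀¹ max_y |H(t, y)| dt` of the loop `h`, where `H` is the normalized
Hamiltonian of `h`. -/
def _root_.HamLoop.HasLength (h : HamLoop Ω) (ℓ : ℝ) : Prop :=
  ∃ H : ℝ → M → ℝ, Ω.IsNormalizedHamiltonian H h.toFun ∧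
    ℓ = ∫ t in (0 : ℝ)..1, ⨆ y : M, |H t y|

/-- Hofer's norm `‖γ‖`: the infimum of the lengths of the smooth loops representing `γ`. -/
def hoferNorm (γ : HamPi1 Ω) : ℝ :=
  sInf {ℓ : ℝ | ∃ h : HamLoop Ω, γ.IsRepresentedBy h ∧ h.HasLength ℓ}

end HamPi1

end

/-!
Let `h` be a strictly ergodic loop with rotation number `α`, and consider the loops
`h_k t = h (t + (k - 1) α) ∘ ⋯ ∘ h (t + α) ∘ h t` (`HamLoop.orbitProduct`).

* `h_k` represents the `k`-th power of the class of `h` (`HamPi1.mk_orbitProduct`): deforming the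
  shifts `j α` to zero gives the pointwise power of `h`, and in a path connected group the pointwise
  product of loops is homotopic to their concatenation (`HamPi1.exists_mk_eq_based`,
  `HamPi1.mk_mul_mk_iterate`). As all loops of a homotopy have to consist
  of Hamiltonian diffeomorphisms, this uses that Hamiltonian flows preserve `Ω`
  (`SymplecticForm.Generates.isSymplecto`), so that `Ham` is closed under products and its elements
  are joined to the identity inside `Ham`.
* As `φ t ∘ ψ t` is generated by `H t + K t ∘ (φ t)⁻¹` when `φ` and `ψ` are generated by `H` and
  `K` (`SymplecticForm.Generates.trans`), the normalized Hamiltonian of `h_k`, evaluated at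
  `(t, h_k t y)`, is the `k`-th Birkhoff sum at `(t, y)` of the function
  `F (t, y) = H t (h t y)` for the skew product (`HamLoop.exists_hamiltonian_orbitProduct`).
* Symplectomorphisms preserve the symplectic volume
  (`SymplecticForm.IsSymplecto.measurePreserving`), so the skew product preserves the product of
  Haar measure and normalized symplectic volume. By unique ergodicity this is the only invariant
  probability measure, and `F` has mean zero with respect to it, because `H` is normalized.
* For a continuous map with a unique invariant probability measure, the Birkhoff averages of a
  continuous function of mean zero converge to zero uniformly
  (`exists_forall_abs_birkhoffSum_le`). Hence the length of `h_k` is `o(k)`.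
-/

noncomputable section

/-! ### Uniform convergence of Birkhoff sums -/

open Filter in
/-- If `T` has only one invariant probability measure `μ`, then the Birkhoff averages of a
continuous function of `μ`-mean zero tend to zero uniformly.  Otherwise the uniform measures on
orbit segments along which the averages stay away from zero would accumulate at an invariant
probability measure giving the function a non-zero mean. -/
theorem exists_forall_abs_birkhoffSum_le {X : Type*} [TopologicalSpace X] [CompactSpace X]
    [TopologicalSpace.MetrizableSpace X] [MeasurableSpace X] [BorelSpace X] {T : X → X}
    (hT : Continuous T) {μ : Measure X}
    (huniq : ∀ ν : Measure X, IsProbabilityMeasure ν → MeasurePreserving T ν ν → ν = μ)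
    {f : X → ℝ} (hf : Continuous f) (hf0 : ∫ x, f x ∂μ = 0) {ε : ℝ} (hε : 0 < ε) :
    ∃ N : ℕ, ∀ k ≥ N, ∀ x, |birkhoffSum T f k x| ≤ ε * k := by
  by_contra! hcon
  choose κ hκ x hx using hcon
  have hκpos : ∀ m, 0 < κ m := by
    intro m
    rcases Nat.eq_zero_or_pos (κ m) with h | h
    · have := hx m
      simp [h] at this
    · exact h
  have hκ0 : ∀ m, (κ m : ℝ) ≠ 0 := fun m => by exact_mod_cast (hκpos m).ne'
  have hκlim : Tendsto (fun m => (κ m : ℝ)) atTop atTop :=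
    tendsto_natCast_atTop_atTop.comp (tendsto_atTop_mono hκ tendsto_id)
  -- the uniform measures on the orbit segments of length `κ m` of the points `x m`
  let e : ℕ → Measure X := fun m =>
    (κ m : ENNReal)⁻¹ • ∑ j ∈ Finset.range (κ m), Measure.dirac (T^[j] (x m))
  have he : ∀ m, IsProbabilityMeasure (e m) := by
    intro m
    refine ⟨?_⟩
    simp only [e, Measure.smul_apply, Measure.coe_finsetSum, Finset.sum_apply, measure_univ,
      Finset.sum_const, Finset.card_range, nsmul_eq_mul, mul_one, smul_eq_mul]
    exact ENNReal.inv_mul_cancel (by exact_mod_cast (hκpos m).ne') (by simp)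
  have heint : ∀ m, ∀ g : X → ℝ, Continuous g →
      ∫ y, g y ∂(e m) = (κ m : ℝ)⁻¹ * birkhoffSum T g (κ m) (x m) := by
    intro m g hg
    simp only [e]
    rw [integral_smul_measure, integral_finsetSum_measure]
    · simp [birkhoffSum, hg.stronglyMeasurable]
    · intro i _
      exact hg.integrable_of_hasCompactSupport (HasCompactSupport.of_compactSpace g)
  let p : ℕ → ProbabilityMeasure X := fun m => ⟨e m, he m⟩
  let U : Ultrafilter ℕ := Ultrafilter.of atTop
  have hU : (U : Filter ℕ) ≤ atTop := Ultrafilter.of_le atTop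
  obtain ⟨ν, hν⟩ : ∃ ν, Tendsto p U (𝓝 ν) :=
    ⟨(U.map p).lim, (U.map p).le_nhds_lim⟩
  rw [ProbabilityMeasure.tendsto_iff_forall_integral_tendsto] at hν
  have hint : ∀ g : X → ℝ, Continuous g →
      Tendsto (fun m => (κ m : ℝ)⁻¹ * birkhoffSum T g (κ m) (x m)) U
        (𝓝 (∫ y, g y ∂(ν : Measure X))) := by
    intro g hg
    have := hν (BoundedContinuousFunction.mkOfCompact ⟨g, hg⟩)
    simpa [p, heint _ g hg] using! this
  have hinv : MeasurePreserving T (ν : Measure X) (ν : Measure X) := by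
    refine ⟨hT.measurable, ?_⟩
    have : IsProbabilityMeasure ((ν : Measure X).map T) :=
      Measure.isProbabilityMeasure_map hT.aemeasurable
    apply ext_of_forall_integral_eq_of_IsFiniteMeasure
    intro g
    rw [integral_map hT.aemeasurable g.continuous.aestronglyMeasurable]
    refine tendsto_nhds_unique (hint (fun y => g (T y)) (g.continuous.comp hT)) ?_
    have h1 := hint g g.continuous
    have h2 : Tendsto (fun m => (κ m : ℝ)⁻¹ * (2 * ‖g‖)) U (𝓝 0) := by
      have := (hκlim.inv_tendsto_atTop.mono_left hU).mul_const (2 * ‖g‖)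
      simpa using this
    have h3 : Tendsto (fun m => (κ m : ℝ)⁻¹ * birkhoffSum T (fun y => g (T y)) (κ m) (x m)
        - (κ m : ℝ)⁻¹ * birkhoffSum T g (κ m) (x m)) U (𝓝 0) := by
      refine squeeze_zero_norm (fun m => ?_) h2
      rw [← mul_sub, norm_mul, norm_inv, Real.norm_natCast]
      have h4 : birkhoffSum T (fun y => g (T y)) (κ m) (x m) - birkhoffSum T g (κ m) (x m)
          = g (T^[κ m] (x m)) - g (x m) := by
        have : birkhoffSum T (fun y => g (T y)) (κ m) (x m)
            = birkhoffSum T g (κ m) (T (x m)) := by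
          simp [birkhoffSum, ← Function.iterate_succ_apply, Function.iterate_succ_apply']
        rw [this, birkhoffSum_apply_sub_birkhoffSum]
      rw [h4]
      gcongr
      calc ‖g (T^[κ m] (x m)) - g (x m)‖ ≤ ‖g (T^[κ m] (x m))‖ + ‖g (x m)‖ := norm_sub_le _ _
        _ ≤ 2 * ‖g‖ := by linarith [g.norm_coe_le_norm (T^[κ m] (x m)), g.norm_coe_le_norm (x m)]
    simpa using h3.add h1
  have hνμ := huniq ν inferInstance hinv
  have hfν := hint f hf
  rw [hνμ, hf0] at hfν
  have hlow : ∀ m, ε ≤ |(κ m : ℝ)⁻¹ * birkhoffSum T f (κ m) (x m)| := by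
    intro m
    have hk : (0 : ℝ) < κ m := by exact_mod_cast hκpos m
    rw [abs_mul, abs_inv, Nat.abs_cast, inv_mul_eq_div, le_div_iff₀ hk]
    exact (hx m).le
  have := ge_of_tendsto' hfν.abs hlow
  simp at this
  linarith

/-! ### Pull-backs of 2-forms to normed spaces -/

section Pullback

variable {n : ℕ} {M : Type*} [TopologicalSpace M] [ChartedSpace (R2n n) M]
  {E : Type*} [NormedAddCommGroup E] [NormedSpace ℝ E]

/-- The pull-back of a 2-form on `M` under a map `Φ` from a normed space to `M`.  For the inverse
of a chart it is the expression of the form in that chart. -/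
def TwoForm.pullback (w : TwoForm n M) (Φ : E → M) (q : E) : E [⋀^Fin 2]→L[ℝ] ℝ :=
  (w (Φ q)).compContinuousLinearMap (mfderiv 𝓘(ℝ, E) 𝓘(ℝ, R2n n) Φ q)

theorem TwoForm.inChart_eq_pullback (w : TwoForm n M) (x₀ : M) :
    w.inChart x₀ = w.pullback (extChartAt 𝓘(ℝ, R2n n) x₀).symm := rfl

variable [IsManifold 𝓘(ℝ, R2n n) ∞ M]

theorem contMDiffAt_extChartAt_symm {x : M} {z : R2n n}
    (hz : z ∈ (extChartAt 𝓘(ℝ, R2n n) x).target) :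
    ContMDiffAt 𝓘(ℝ, R2n n) 𝓘(ℝ, R2n n) ∞ (extChartAt 𝓘(ℝ, R2n n) x).symm z :=
  (contMDiffOn_extChartAt_symm (n := ∞) x).contMDiffAt
    ((isOpen_extChartAt_target x).mem_nhds hz)

/-- The pull-back under `Φ` is the pull-back, in the sense of normed spaces, of the expression of
the form in a chart. -/
theorem TwoForm.pullback_eq_inChart (w : TwoForm n M) {Φ : E → M} {q : E} (x₀ : M)
    (hΦ : MDifferentiableAt 𝓘(ℝ, E) 𝓘(ℝ, R2n n) Φ q)
    (hq : Φ q ∈ (extChartAt 𝓘(ℝ, R2n n) x₀).source) :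
    w.pullback Φ q = (w.inChart x₀ (extChartAt 𝓘(ℝ, R2n n) x₀ (Φ q))).compContinuousLinearMap
      (fderiv ℝ (fun q' => extChartAt 𝓘(ℝ, R2n n) x₀ (Φ q')) q) := by
  set e := extChartAt 𝓘(ℝ, R2n n) x₀ with he
  have hsrc : Φ q ∈ (chartAt (R2n n) x₀).source := by rwa [← extChartAt_source 𝓘(ℝ, R2n n)]
  have h1 : MDifferentiableAt 𝓘(ℝ, R2n n) 𝓘(ℝ, R2n n) e (Φ q) :=
    (contMDiffAt_extChartAt' (n := ∞) hsrc).mdifferentiableAt (by simp)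
  have h2 : MDifferentiableAt 𝓘(ℝ, E) 𝓘(ℝ, R2n n) (fun q' => e (Φ q')) q := h1.comp q hΦ
  have h3 : MDifferentiableAt 𝓘(ℝ, R2n n) 𝓘(ℝ, R2n n) e.symm (e (Φ q)) :=
    (contMDiffAt_extChartAt_symm (e.map_source hq)).mdifferentiableAt (by simp)
  have h4 : Φ =ᶠ[𝓝 q] fun q' => e.symm (e (Φ q')) := by
    filter_upwards [hΦ.continuousAt.preimage_mem_nhds
      ((isOpen_extChartAt_source x₀).mem_nhds hq)] with q' hq'
    exact (e.left_inv hq').symm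
  have h5 := h4.mfderiv_eq (I := 𝓘(ℝ, E)) (I' := 𝓘(ℝ, R2n n))
  have h6 := mfderiv_comp q h3 h2
  have h7 : mfderiv 𝓘(ℝ, E) 𝓘(ℝ, R2n n) (fun q' => e (Φ q')) q
    = fderiv ℝ (fun q' => e (Φ q')) q := mfderiv_eq_fderiv
  have h8 : e.symm (e (Φ q)) = Φ q := e.left_inv hq
  -- The values of `w` at equal points have different types unless the tangent spaces are unfolded.
  have h9 : ∀ y, y = Φ q → (w y : (R2n n) [⋀^Fin 2]→L[ℝ] ℝ) = w (Φ q) := by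
    rintro y rfl
    rfl
  have h10 : (mfderiv 𝓘(ℝ, E) 𝓘(ℝ, R2n n) Φ q : E →L[ℝ] R2n n) =
      (mfderiv 𝓘(ℝ, R2n n) 𝓘(ℝ, R2n n) e.symm (e (Φ q)) : R2n n →L[ℝ] R2n n).comp
        (fderiv ℝ (F := R2n n) (fun q' => e (Φ q')) q) :=
    (h5.trans h6).trans (congrArg (fun L : E →L[ℝ] R2n n =>
      (mfderiv 𝓘(ℝ, R2n n) 𝓘(ℝ, R2n n) e.symm (e (Φ q)) : R2n n →L[ℝ] R2n n).comp L) h7)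
  ext v
  change (w (Φ q) : (R2n n) [⋀^Fin 2]→L[ℝ] ℝ)
      (fun i => (mfderiv 𝓘(ℝ, E) 𝓘(ℝ, R2n n) Φ q : E →L[ℝ] R2n n) (v i)) =
    (w (e.symm (e (Φ q))) : (R2n n) [⋀^Fin 2]→L[ℝ] ℝ) (fun i =>
      (mfderiv 𝓘(ℝ, R2n n) 𝓘(ℝ, R2n n) e.symm (e (Φ q)) : R2n n →L[ℝ] R2n n)
        (fderiv ℝ (fun q' => e (Φ q')) q (v i)))
  rw [h9 _ h8, h10]
  rfl

/-- Pull-backs under smooth maps of a symplectic form are differentiable and closed. -/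
theorem SymplecticForm.differentiableAt_pullback_and_extDeriv_eq_zero (Ω : SymplecticForm n M)
    {Φ : E → M} {q : E}
    (hΦ : ∀ᶠ q' in 𝓝 q, ContMDiffAt 𝓘(ℝ, E) 𝓘(ℝ, R2n n) ∞ Φ q') :
    DifferentiableAt ℝ (Ω.form.pullback Φ) q ∧ extDeriv (Ω.form.pullback Φ) q = 0 := by
  set x₀ := Φ q with hx₀
  set e := extChartAt 𝓘(ℝ, R2n n) x₀ with he
  have hq : Φ q ∈ e.source := mem_extChartAt_source x₀
  have hcont := hΦ.self_of_nhds.continuousAt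
  have hev : Ω.form.pullback Φ =ᶠ[𝓝 q] fun q' =>
      (Ω.form.inChart x₀ (e (Φ q'))).compContinuousLinearMap
        (fderiv ℝ (fun q'' => e (Φ q'')) q') := by
    filter_upwards [hΦ, hcont.preimage_mem_nhds ((isOpen_extChartAt_source x₀).mem_nhds hq)]
      with q' h1 h2
    exact Ω.form.pullback_eq_inChart x₀ (h1.mdifferentiableAt (by simp)) h2
  have hsm : ContDiffAt ℝ ∞ (fun q'' => e (Φ q'')) q := by
    rw [← contMDiffAt_iff_contDiffAt]
    exact (contMDiffAt_extChartAt' (n := ∞) (by simp [hx₀])).comp q hΦ.self_of_nhds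
  have hw : DifferentiableAt ℝ (Ω.form.inChart x₀) (e (Φ q)) :=
    ((Ω.smooth x₀).contDiffAt ((isOpen_extChartAt_target x₀).mem_nhds
      (e.map_source hq))).differentiableAt (by simp)
  constructor
  · refine DifferentiableAt.congr_of_eventuallyEq ?_ hev
    have h1 : DifferentiableAt ℝ (fun q' => Ω.form.inChart x₀ (e (Φ q'))) q :=
      DifferentiableAt.comp (g := Ω.form.inChart x₀) q hw (hsm.differentiableAt (by simp))
    have h2 : DifferentiableAt ℝ (fderiv ℝ (fun q'' => e (Φ q''))) q :=
      (hsm.fderiv_right (m := 1) (by norm_cast)).differentiableAt (by simp)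
    exact h1.continuousAlternatingMapCompContinuousLinearMap h2
  · have h1 := extDeriv_pullback (f := fun q'' => e (Φ q'')) hw
      (hsm.of_le (m := 2) (by norm_cast)) (by simp)
    rw [hev.extDeriv_eq, h1, Ω.closed x₀ _ (e.map_source hq)]
    rfl

omit [IsManifold 𝓘(ℝ, R2n n) ∞ M] in
theorem TwoForm.pullback_comp (w : TwoForm n M) {φ : M → M} {χ : E → M} {q : E}
    (hφ : MDifferentiableAt 𝓘(ℝ, R2n n) 𝓘(ℝ, R2n n) φ (χ q))
    (hχ : MDifferentiableAt 𝓘(ℝ, E) 𝓘(ℝ, R2n n) χ q) :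
    w.pullback (fun q' => φ (χ q')) q =
      ((w (φ (χ q))).compContinuousLinearMap (mfderiv 𝓘(ℝ, R2n n) 𝓘(ℝ, R2n n) φ (χ q)) :
        (R2n n) [⋀^Fin 2]→L[ℝ] ℝ).compContinuousLinearMap (mfderiv 𝓘(ℝ, E) 𝓘(ℝ, R2n n) χ q) := by
  have h := mfderiv_comp q hφ hχ
  ext v
  refine congrArg (w (φ (χ q))) (funext fun i => ?_)
  exact congrArg (fun L : E →L[ℝ] R2n n => L (v i)) h

theorem surjective_mfderiv_extChartAt_symm {x : M} {z : R2n n}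
    (hz : z ∈ (extChartAt 𝓘(ℝ, R2n n) x).target) : Function.Surjective
      (mfderiv 𝓘(ℝ, R2n n) 𝓘(ℝ, R2n n) (extChartAt 𝓘(ℝ, R2n n) x).symm z) := by
  have h := isInvertible_mfderivWithin_extChartAt_symm hz
  rw [ModelWithCorners.range_eq_univ, mfderivWithin_univ] at h
  exact h.bijective.surjective

end Pullback

/-! ### Hamiltonian flows preserve the symplectic form -/

namespace SymplecticForm

variable {n : ℕ} {M : Type*} [TopologicalSpace M] [ChartedSpace (R2n n) M]

theorem IsSmoothFamily.contMDiff_curve {ψ : ℝ → (M ≃ₘ⟮𝓘(ℝ, R2n n), 𝓘(ℝ, R2n n)⟯ M)}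
    (hψ : IsSmoothFamily ψ) (y : M) : ContMDiff 𝓘(ℝ, ℝ) 𝓘(ℝ, R2n n) ∞ (fun s : ℝ => ψ s y) :=
  hψ.1.comp (contMDiff_id.prodMk contMDiff_const)

theorem Generates.contMDiff_slice {Ω : SymplecticForm n M}
    {ψ : ℝ → (M ≃ₘ⟮𝓘(ℝ, R2n n), 𝓘(ℝ, R2n n)⟯ M)} {H : ℝ → M → ℝ}
    (hH : Ω.Generates H ψ) (t : ℝ) : ContMDiff 𝓘(ℝ, R2n n) 𝓘(ℝ, ℝ) ∞ (H t) :=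
  hH.1.comp (contMDiff_const.prodMk contMDiff_id)

variable [IsManifold 𝓘(ℝ, R2n n) ∞ M]

omit [IsManifold 𝓘(ℝ, R2n n) ∞ M] in
/-- The pull-back of `Ω` under the track `(t, z) ↦ ψ t (χ z)` of a Hamiltonian isotopy in a local
parametrization `χ` is `dt ∧ dK` plus a form without `dt`, where `K` is the Hamiltonian
along the track. -/
theorem Generates.pullback_apply_time {Ω : SymplecticForm n M}
    {ψ : ℝ → (M ≃ₘ⟮𝓘(ℝ, R2n n), 𝓘(ℝ, R2n n)⟯ M)} {H : ℝ → M → ℝ}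
    (hψ : IsSmoothFamily ψ) (hH : Ω.Generates H ψ) {χ : R2n n → M} {q : ℝ × R2n n}
    (hχ : ContMDiffAt 𝓘(ℝ, R2n n) 𝓘(ℝ, R2n n) ∞ χ q.2) (v : R2n n) :
    Ω.form.pullback (fun p : ℝ × R2n n => ψ p.1 (χ p.2)) q ![(1, 0), (0, v)] =
      fderiv ℝ (fun p : ℝ × R2n n => H p.1 (ψ p.1 (χ p.2))) q (0, v) := by
  obtain ⟨t, z⟩ := q
  set Φ : ℝ × R2n n → M := fun p => ψ p.1 (χ p.2) with hΦ
  have hΦs : ContMDiffAt 𝓘(ℝ, ℝ × R2n n) 𝓘(ℝ, R2n n) ∞ Φ (t, z) := by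
    refine hψ.1.contMDiffAt.comp (t, z) (ContMDiffAt.prodMk ?_ ?_)
    · exact contDiff_fst.contMDiff.contMDiffAt
    · exact ContMDiffAt.comp (I' := 𝓘(ℝ, R2n n)) (t, z) hχ contDiff_snd.contMDiff.contMDiffAt
  have hΦd := hΦs.mdifferentiableAt (by simp)
  have hKs : ContMDiffAt 𝓘(ℝ, ℝ × R2n n) 𝓘(ℝ, ℝ) ∞ (fun p => H p.1 (Φ p)) (t, z) :=
    hH.1.contMDiffAt.comp (t, z) (contDiff_fst.contMDiff.contMDiffAt.prodMk hΦs)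
  have hKd : DifferentiableAt ℝ (fun p => H p.1 (Φ p)) (t, z) :=
    hKs.contDiffAt.differentiableAt (by simp)
  have htime : mfderiv 𝓘(ℝ, ℝ × R2n n) 𝓘(ℝ, R2n n) Φ (t, z) ((1 : ℝ), (0 : R2n n))
      = velocity ψ t (χ z) := by
    have hi : HasMFDerivAt 𝓘(ℝ, ℝ) 𝓘(ℝ, ℝ × R2n n) (fun s : ℝ => (s, z)) t
        (ContinuousLinearMap.inl ℝ ℝ (R2n n)) :=
      (hasFDerivAt_prodMk_left t z).hasMFDerivAt
    have := (HasMFDerivAt.comp t hΦd.hasMFDerivAt hi).mfderiv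
    exact (congrArg (fun L : ℝ →L[ℝ] R2n n => L 1) this).symm
  have hi : HasMFDerivAt 𝓘(ℝ, R2n n) 𝓘(ℝ, ℝ × R2n n) (fun y : R2n n => (t, y)) z
      (ContinuousLinearMap.inr ℝ ℝ (R2n n)) :=
    (hasFDerivAt_prodMk_right t z).hasMFDerivAt
  have hslice := HasMFDerivAt.comp z hΦd.hasMFDerivAt hi
  have h1 := (HasMFDerivAt.comp z
    (((hH.contMDiff_slice t).mdifferentiableAt (x := Φ (t, z)) (by simp)).hasMFDerivAt)
    hslice).mfderiv
  have h2 : fderiv ℝ (fun y => H t (Φ (t, y))) z v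
      = fderiv ℝ (fun p : ℝ × R2n n => H p.1 (Φ p)) (t, z) (0, v) := by
    have := (hKd.hasFDerivAt.comp z (hasFDerivAt_prodMk_right t z)).fderiv
    exact congrArg (fun L : R2n n →L[ℝ] ℝ => L v) this
  rw [← h2, ← mfderiv_eq_fderiv]
  refine Eq.trans ?_ (congrArg (fun L : R2n n →L[ℝ] ℝ => L v) h1).symm
  refine Eq.trans ?_ (hH.2 t (χ z) (mfderiv 𝓘(ℝ, ℝ × R2n n) 𝓘(ℝ, R2n n) Φ (t, z) (0, v)))
  rw [← htime]
  refine congrArg (Ω.form (ψ t (χ z))) ?_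
  funext i
  fin_cases i <;> rfl

/-- A Hamiltonian isotopy starting at the identity consists of symplectomorphisms: as `Ω` is
closed, and its contraction with the generating vector field is exact, the derivative in time of
the pulled-back form vanishes. -/
theorem Generates.isSymplecto {Ω : SymplecticForm n M}
    {ψ : ℝ → (M ≃ₘ⟮𝓘(ℝ, R2n n), 𝓘(ℝ, R2n n)⟯ M)} {H : ℝ → M → ℝ}
    (hψ : IsSmoothFamily ψ) (hH : Ω.Generates H ψ) (h0 : ∀ y, ψ 0 y = y) (t : ℝ) :
    Ω.IsSymplecto (ψ t) := by
  intro x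
  set e := extChartAt 𝓘(ℝ, R2n n) x with he
  set χ := e.symm with hχdef
  have hχ : ∀ z ∈ e.target, ContMDiffAt 𝓘(ℝ, R2n n) 𝓘(ℝ, R2n n) ∞ χ z := fun z hz =>
    contMDiffAt_extChartAt_symm hz
  have hz : e x ∈ e.target := mem_extChartAt_target x
  set Φ : ℝ × R2n n → M := fun p => ψ p.1 (χ p.2) with hΦ
  have hnear : ∀ t : ℝ, ∀ᶠ q : ℝ × R2n n in 𝓝 (t, e x), q.2 ∈ e.target := fun t =>
    continuousAt_snd.preimage_mem_nhds ((isOpen_extChartAt_target x).mem_nhds hz)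
  have hΦs : ∀ q : ℝ × R2n n, q.2 ∈ e.target →
      ContMDiffAt 𝓘(ℝ, ℝ × R2n n) 𝓘(ℝ, R2n n) ∞ Φ q := by
    intro q hq
    refine hψ.1.contMDiffAt.comp q (ContMDiffAt.prodMk ?_ ?_)
    · exact contDiff_fst.contMDiff.contMDiffAt
    · exact ContMDiffAt.comp (I' := 𝓘(ℝ, R2n n)) q (hχ _ hq) contDiff_snd.contMDiff.contMDiffAt
  set β := Ω.form.pullback Φ with hβ
  have hconst : ∀ (u v : R2n n) (t : ℝ),
      β (t, e x) ![(0, u), (0, v)] = β (0, e x) ![(0, u), (0, v)] := by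
    intro u v
    have hd : ∀ t : ℝ, HasDerivAt (fun s : ℝ => β (s, e x) ![(0, u), (0, v)]) 0 t := by
      intro t
      obtain ⟨hβd, hβc⟩ := Ω.differentiableAt_pullback_and_extDeriv_eq_zero
        ((hnear t).mono hΦs)
      set K : ℝ × R2n n → ℝ := fun p => H p.1 (Φ p) with hK
      have hKs : ContDiffAt ℝ ∞ K (t, e x) := by
        rw [← contMDiffAt_iff_contDiffAt]
        exact hH.1.contMDiffAt.comp (t, e x)
          (contDiff_fst.contMDiff.contMDiffAt.prodMk (hΦs _ hz))
      have hKd : DifferentiableAt ℝ (fderiv ℝ K) (t, e x) :=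
        (hKs.fderiv_right (m := 1) (by norm_cast)).differentiableAt (by simp)
      have hsymm : fderiv ℝ (fderiv ℝ K) (t, e x) (0, u) (0, v)
          = fderiv ℝ (fderiv ℝ K) (t, e x) (0, v) (0, u) :=
        (hKs.isSymmSndFDerivAt (by simp; norm_cast)).eq (0, u) (0, v)
      have htime : ∀ w : R2n n, fderiv ℝ (fun q => β q ![(1, 0), (0, w)]) (t, e x)
          = (fderiv ℝ (fderiv ℝ K) (t, e x)).flip (0, w) := by
        intro w
        have h1 : (fun q => β q ![(1, 0), (0, w)]) =ᶠ[𝓝 (t, e x)]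
            fun q => fderiv ℝ K q (0, w) := by
          filter_upwards [hnear t] with q hq
          exact hH.pullback_apply_time hψ (hχ _ hq) w
        rw [h1.fderiv_eq]
        ext y
        · rw [fderiv_clm_apply hKd (differentiableAt_const _)]
          simp
        · rw [fderiv_clm_apply hKd (differentiableAt_const _)]
          simp
      -- `0 = dβ(∂ₜ, u, v) = ∂ₜ β(u, v) - ∂ᵤ β(∂ₜ, v) + ∂ᵥ β(∂ₜ, u)`, where the last two terms are
      -- second derivatives of `K` and cancel by symmetry.
      have h0 := extDeriv_apply hβd ![((1 : ℝ), (0 : R2n n)), (0, u), (0, v)]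
      rw [hβc] at h0
      have r0 : Fin.removeNth 0 ![((1 : ℝ), (0 : R2n n)), (0, u), (0, v)]
          = ![(0, u), (0, v)] := by
        funext i; fin_cases i <;> rfl
      have r1 : Fin.removeNth 1 ![((1 : ℝ), (0 : R2n n)), (0, u), (0, v)]
          = ![(1, 0), (0, v)] := by
        funext i; fin_cases i <;> rfl
      have r2 : Fin.removeNth 2 ![((1 : ℝ), (0 : R2n n)), (0, u), (0, v)]
          = ![(1, 0), (0, u)] := by
        funext i; fin_cases i <;> rfl
      rw [Fin.sum_univ_three, r0, r1, r2, htime, htime] at h0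
      simp only [Fin.val_zero, Fin.val_one, Fin.val_two,
        pow_zero, pow_one, one_smul, neg_smul, even_two, Even.neg_pow, one_pow,
        Matrix.cons_val_zero, Matrix.cons_val_one, Matrix.cons_val, ContinuousLinearMap.flip_apply]
        at h0
      change 0 = fderiv ℝ (fun q => β q ![(0, u), (0, v)]) (t, e x) (1, 0) + _ + _ at h0
      have h1 : fderiv ℝ (fun q => β q ![(0, u), (0, v)]) (t, e x) (1, 0) = 0 := by linarith
      have h2 : DifferentiableAt ℝ (fun q => β q ![(0, u), (0, v)]) (t, e x) :=
        hβd.continuousAlternatingMap_apply fun _ => differentiableAt_const _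
      have h3 := (h2.hasFDerivAt.comp t (hasFDerivAt_prodMk_left t (e x))).hasDerivAt
      have h4 : ((fderiv ℝ (fun q => β q ![(0, u), (0, v)]) (t, e x)).comp
          (ContinuousLinearMap.inl ℝ ℝ (R2n n))) 1 = 0 := h1
      rwa [h4] at h3
    intro t
    exact is_const_of_deriv_eq_zero (fun t => (hd t).differentiableAt) (fun t => (hd t).deriv) t 0
  have hpull : ∀ (t : ℝ) (u v : R2n n), β (t, e x) ![(0, u), (0, v)] =
      Ω.form.pullback (fun z => ψ t (χ z)) (e x) ![u, v] := by
    intro t u v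
    have hi : HasMFDerivAt 𝓘(ℝ, R2n n) 𝓘(ℝ, ℝ × R2n n) (fun y : R2n n => (t, y)) (e x)
        (ContinuousLinearMap.inr ℝ ℝ (R2n n)) :=
      (hasFDerivAt_prodMk_right t (e x)).hasMFDerivAt
    have h1 := (HasMFDerivAt.comp (e x)
      (((hΦs (t, e x) hz).mdifferentiableAt (by simp)).hasMFDerivAt) hi).mfderiv
    refine congrArg (Ω.form (ψ t (χ (e x)))) (funext fun i => ?_)
    refine Eq.trans ?_ (congrArg (fun L : R2n n →L[ℝ] R2n n => L (![u, v] i)) h1).symm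
    fin_cases i <;> rfl
  have hχx : χ (e x) = x := extChartAt_to_inv x
  have hmd := (hχ _ hz).mdifferentiableAt (by simp)
  suffices h : (Ω.form (ψ t (χ (e x)))).compContinuousLinearMap
      (mfderiv 𝓘(ℝ, R2n n) 𝓘(ℝ, R2n n) (ψ t) (χ (e x))) = Ω.form (χ (e x)) by rwa [hχx] at h
  have hid : (fun z => ψ 0 (χ z)) = χ := funext fun z => h0 _
  ext w
  obtain ⟨u, hu⟩ : ∃ u : R2n n, mfderiv 𝓘(ℝ, R2n n) 𝓘(ℝ, R2n n) χ (e x) u = w 0 :=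
    surjective_mfderiv_extChartAt_symm hz (w 0)
  obtain ⟨v, hv⟩ : ∃ v : R2n n, mfderiv 𝓘(ℝ, R2n n) 𝓘(ℝ, R2n n) χ (e x) v = w 1 :=
    surjective_mfderiv_extChartAt_symm hz (w 1)
  have hw : w = fun i => mfderiv 𝓘(ℝ, R2n n) 𝓘(ℝ, R2n n) χ (e x) (![u, v] i) := by
    funext i
    fin_cases i
    · exact hu.symm
    · exact hv.symm
  have h1 := hconst u v t
  rw [hpull, hpull, hid, TwoForm.pullback_comp _
    (((ψ t).contMDiff.mdifferentiable (by simp)) _) hmd] at h1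
  rw [hw]
  exact h1

end SymplecticForm

/-! ### The density of the symplectic volume -/

section Gram

/-- A real skew-symmetric matrix with non-zero determinant has positive determinant: the segment
from it to the identity matrix contains no singular matrix. -/
theorem Matrix.det_pos_of_transpose_eq_neg {ι : Type*} [Fintype ι] [DecidableEq ι]
    {A : Matrix ι ι ℝ} (hA : A.transpose = -A) (h0 : A.det ≠ 0) : 0 < A.det := by
  let p : ℝ → ℝ := fun s => ((1 - s) • A + s • (1 : Matrix ι ι ℝ)).det
  have hp : Continuous p := by
    refine Continuous.matrix_det ?_
    fun_prop
  have hpne : ∀ s, 0 ≤ s → p s ≠ 0 := by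
    intro s hs hps
    rcases hs.eq_or_lt with rfl | hs
    · simp [p, h0] at hps
    obtain ⟨v, hv, hv0⟩ := Matrix.exists_mulVec_eq_zero_iff.2 hps
    have hskew : v ⬝ᵥ (A.mulVec v) = 0 := by
      have h1 : v ⬝ᵥ (A.mulVec v) = v ⬝ᵥ (A.transpose.mulVec v) := by
        rw [Matrix.mulVec_transpose, Matrix.dotProduct_mulVec, dotProduct_comm]
      rw [hA, Matrix.neg_mulVec, dotProduct_neg] at h1
      linarith
    have h2 := congrArg (fun u => v ⬝ᵥ u) hv0
    simp only [Matrix.add_mulVec, Matrix.smul_mulVec, Matrix.one_mulVec, dotProduct_add,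
      dotProduct_smul, hskew, smul_eq_mul, mul_zero, zero_add, dotProduct_zero, mul_eq_zero,
      hs.ne', false_or] at h2
    exact hv (dotProduct_self_eq_zero.1 h2)
  by_contra hneg
  have h1 : p 1 = 1 := by simp [p]
  have h2 : p 0 = A.det := by simp [p]
  obtain ⟨s, hs, hs0⟩ := intermediate_value_Icc (zero_le_one' ℝ) hp.continuousOn
    (show (0 : ℝ) ∈ Set.Icc (p 0) (p 1) by rw [h1, h2]; exact ⟨not_lt.1 hneg, zero_le_one⟩)
  exact hpne s hs.1 hs0

variable {n : ℕ}

/-- The bilinear form underlying an alternating form of degree two. -/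
def ContinuousAlternatingMap.toBilin (w : (R2n n) [⋀^Fin 2]→L[ℝ] ℝ) :
    LinearMap.BilinForm ℝ (R2n n) :=
  have h0 : ∀ u v x : R2n n, Function.update ![u, v] 0 x = ![x, v] := by
    intro u v x; ext i; fin_cases i <;> simp
  have h1 : ∀ u v x : R2n n, Function.update ![u, v] 1 x = ![u, x] := by
    intro u v x; ext i; fin_cases i <;> simp
  LinearMap.mk₂ ℝ (fun u v => w ![u, v])
    (fun u u' v => by simpa [h0] using w.map_update_add ![u, v] 0 u u')
    (fun c u v => by simpa [h0] using w.map_update_smul ![u, v] 0 c u)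
    (fun u v v' => by simpa [h1] using w.map_update_add ![u, v] 1 v v')
    (fun c u v => by simpa [h1] using w.map_update_smul ![u, v] 1 c v)

@[simp]
theorem ContinuousAlternatingMap.toBilin_apply (w : (R2n n) [⋀^Fin 2]→L[ℝ] ℝ) (u v : R2n n) :
    w.toBilin u v = w ![u, v] := rfl

/-- The Gram matrix of an alternating form of degree two in the standard basis of `ℝ²ⁿ`. -/
def ContinuousAlternatingMap.gram (w : (R2n n) [⋀^Fin 2]→L[ℝ] ℝ) :
    Matrix (Fin (2 * n)) (Fin (2 * n)) ℝ :=
  Matrix.of fun i j => w ![EuclideanSpace.single i 1, EuclideanSpace.single j 1]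

theorem ContinuousAlternatingMap.gram_eq_toMatrix (w : (R2n n) [⋀^Fin 2]→L[ℝ] ℝ) :
    w.gram = LinearMap.BilinForm.toMatrix (EuclideanSpace.basisFun _ ℝ).toBasis w.toBilin := by
  ext i j
  simp [gram, LinearMap.BilinForm.toMatrix_apply]

theorem ContinuousAlternatingMap.det_gram_comp (w : (R2n n) [⋀^Fin 2]→L[ℝ] ℝ)
    (A : R2n n →L[ℝ] R2n n) :
    (w.compContinuousLinearMap A).gram.det = A.det ^ 2 * w.gram.det := by
  have h : (w.compContinuousLinearMap A).toBilin =
      w.toBilin.comp (A : R2n n →ₗ[ℝ] R2n n) (A : R2n n →ₗ[ℝ] R2n n) := by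
    ext u v
    simp only [toBilin_apply, LinearMap.BilinForm.comp_apply, compContinuousLinearMap_apply]
    refine congrArg w (funext fun i => ?_)
    fin_cases i <;> rfl
  rw [gram_eq_toMatrix, gram_eq_toMatrix, h,
    LinearMap.BilinForm.toMatrix_comp (EuclideanSpace.basisFun _ ℝ).toBasis
      (EuclideanSpace.basisFun _ ℝ).toBasis, Matrix.det_mul,
    Matrix.det_mul, Matrix.det_transpose, LinearMap.det_toMatrix, ContinuousLinearMap.det]
  ring

theorem ContinuousAlternatingMap.apply_swap (w : (R2n n) [⋀^Fin 2]→L[ℝ] ℝ) (u v : R2n n) :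
    w ![u, v] = -w ![v, u] := by
  have h : w (![v, u] ∘ Equiv.swap 0 1) = -w ![v, u] :=
    w.toAlternatingMap.map_swap ![v, u] (show (0 : Fin 2) ≠ 1 by simp)
  rw [← h]
  refine congrArg w (funext fun k => ?_)
  fin_cases k <;> simp

theorem ContinuousAlternatingMap.det_gram_pos (w : (R2n n) [⋀^Fin 2]→L[ℝ] ℝ)
    (hw : ∀ u, (∀ v, w ![u, v] = 0) → u = 0) : 0 < w.gram.det := by
  apply Matrix.det_pos_of_transpose_eq_neg
  · ext i j
    exact w.apply_swap _ _
  · rw [gram_eq_toMatrix, ← LinearMap.BilinForm.nondegenerate_iff_det_ne_zero]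
    refine ⟨fun u hu => hw u hu, fun u hu => hw u fun v => ?_⟩
    rw [w.apply_swap]
    simpa using hu v

end Gram

namespace SymplecticForm

variable {n : ℕ} {M : Type*} [TopologicalSpace M] [ChartedSpace (R2n n) M]

theorem chartDensity_eq (Ω : SymplecticForm n M) (x : M) (z : R2n n) :
    Ω.chartDensity x z = Real.sqrt (Ω.form.inChart x z).gram.det := rfl

theorem IsSymplecto.refl (Ω : SymplecticForm n M) :
    Ω.IsSymplecto (Diffeomorph.refl 𝓘(ℝ, R2n n) M ∞) := by
  intro x
  have h : mfderiv 𝓘(ℝ, R2n n) 𝓘(ℝ, R2n n) (Diffeomorph.refl 𝓘(ℝ, R2n n) M ∞) x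
    = ContinuousLinearMap.id ℝ _ := mfderiv_id
  rw [h]
  rfl

theorem IsSymplecto.trans {Ω : SymplecticForm n M}
    {φ ψ : M ≃ₘ⟮𝓘(ℝ, R2n n), 𝓘(ℝ, R2n n)⟯ M} (hφ : Ω.IsSymplecto φ) (hψ : Ω.IsSymplecto ψ) :
    Ω.IsSymplecto (φ.trans ψ) := by
  intro x
  have h := mfderiv_comp x (ψ.mdifferentiable (by simp) (φ x)) (φ.mdifferentiable (by simp) x)
  rw [← hφ x, ← hψ (φ x)]
  ext v
  exact congrArg (Ω.form (ψ (φ x))) (funext fun i =>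
    congrArg (fun L : R2n n →L[ℝ] R2n n => L (v i)) h)

variable [IsManifold 𝓘(ℝ, R2n n) ∞ M]

theorem chartDensity_pos (Ω : SymplecticForm n M) {x : M} {z : R2n n}
    (hz : z ∈ (extChartAt 𝓘(ℝ, R2n n) x).target) : 0 < Ω.chartDensity x z := by
  rw [chartDensity_eq]
  apply Real.sqrt_pos.2
  apply ContinuousAlternatingMap.det_gram_pos
  intro u hu
  have h := isInvertible_mfderivWithin_extChartAt_symm hz
  rw [ModelWithCorners.range_eq_univ, mfderivWithin_univ] at h
  refine h.injective (Eq.trans ?_ (map_zero (mfderiv 𝓘(ℝ, R2n n) 𝓘(ℝ, R2n n)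
    (extChartAt 𝓘(ℝ, R2n n) x).symm z)).symm)
  refine Ω.nondegenerate _ _ fun v => ?_
  obtain ⟨v, rfl⟩ := h.surjective v
  rw [← hu v]
  refine congrArg (Ω.form _) (funext fun i => ?_)
  fin_cases i <;> rfl

omit [IsManifold 𝓘(ℝ, R2n n) ∞ M] in
theorem continuousOn_chartDensity (Ω : SymplecticForm n M) (x : M) :
    ContinuousOn (Ω.chartDensity x) (extChartAt 𝓘(ℝ, R2n n) x).target := by
  refine Real.continuous_sqrt.comp_continuousOn ?_
  refine (continuous_id.matrix_det).comp_continuousOn ?_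
  refine continuousOn_pi.2 fun i => continuousOn_pi.2 fun j => ?_
  exact (ContinuousAlternatingMap.apply ℝ (R2n n) ℝ _).continuous.comp_continuousOn
    (Ω.smooth x).continuousOn

/-- Transformation of the symplectic density under a symplectomorphism expressed in charts; for
the identity this is the change of charts. -/
theorem IsSymplecto.chartDensity_eq_mul {Ω : SymplecticForm n M}
    {φ : M ≃ₘ⟮𝓘(ℝ, R2n n), 𝓘(ℝ, R2n n)⟯ M} (hφ : Ω.IsSymplecto φ) {x x' : M} {z : R2n n}
    (hz : z ∈ (extChartAt 𝓘(ℝ, R2n n) x).target)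
    (hz' : φ ((extChartAt 𝓘(ℝ, R2n n) x).symm z) ∈ (extChartAt 𝓘(ℝ, R2n n) x').source) :
    DifferentiableAt ℝ (fun z => extChartAt 𝓘(ℝ, R2n n) x'
      (φ ((extChartAt 𝓘(ℝ, R2n n) x).symm z))) z ∧
    Ω.chartDensity x z = |(fderiv ℝ (fun z => extChartAt 𝓘(ℝ, R2n n) x'
      (φ ((extChartAt 𝓘(ℝ, R2n n) x).symm z))) z).det| *
      Ω.chartDensity x' (extChartAt 𝓘(ℝ, R2n n) x' (φ ((extChartAt 𝓘(ℝ, R2n n) x).symm z))) := by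
  set χ := (extChartAt 𝓘(ℝ, R2n n) x).symm
  have hχ : MDifferentiableAt 𝓘(ℝ, R2n n) 𝓘(ℝ, R2n n) χ z :=
    (contMDiffAt_extChartAt_symm hz).mdifferentiableAt (by simp)
  have hφd := φ.mdifferentiable (by simp) (χ z)
  have hφχ : MDifferentiableAt 𝓘(ℝ, R2n n) 𝓘(ℝ, R2n n) (fun z => φ (χ z)) z := hφd.comp z hχ
  constructor
  · rw [← mdifferentiableAt_iff_differentiableAt]
    refine MDifferentiableAt.comp z (ContMDiffAt.mdifferentiableAt (n := ∞) ?_ (by simp)) hφχ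
    exact contMDiffAt_extChartAt' (by rwa [← extChartAt_source 𝓘(ℝ, R2n n)])
  have h1 : Ω.form.pullback (fun z => φ (χ z)) z = Ω.form.pullback χ z := by
    rw [TwoForm.pullback_comp _ hφd hχ]
    have := hφ (χ z)
    ext v
    exact congrArg (fun w : (R2n n) [⋀^Fin 2]→L[ℝ] ℝ =>
      w fun i => (mfderiv 𝓘(ℝ, R2n n) 𝓘(ℝ, R2n n) χ z : R2n n →L[ℝ] R2n n) (v i)) this
  have h2 := Ω.form.pullback_eq_inChart x' hφχ hz'
  rw [chartDensity_eq, chartDensity_eq, TwoForm.inChart_eq_pullback _ x, ← h1, h2,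
    ContinuousAlternatingMap.det_gram_comp, Real.sqrt_mul (sq_nonneg _), Real.sqrt_sq_eq_abs]

end SymplecticForm

/-! ### The symplectic volume measure -/

namespace SymplecticForm

variable {n : ℕ} {M : Type*} [TopologicalSpace M] [ChartedSpace (R2n n) M] [MeasurableSpace M]

theorem chartVolume_le_volumeMeasure (Ω : SymplecticForm n M) (x : M) :
    Ω.chartVolume x ≤ Ω.volumeMeasure :=
  le_iSup Ω.chartVolume x

variable [BorelSpace M]

theorem aemeasurable_extChartAt_symm (x : M) :
    AEMeasurable (extChartAt 𝓘(ℝ, R2n n) x).symm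
      ((volume : Measure (R2n n)).restrict (extChartAt 𝓘(ℝ, R2n n) x).target) :=
  (continuousOn_extChartAt_symm x).aemeasurable (isOpen_extChartAt_target x).measurableSet

theorem chartVolume_apply (Ω : SymplecticForm n M) (x : M) {s : Set M} (hs : MeasurableSet s) :
    Ω.chartVolume x s = ∫⁻ z in (extChartAt 𝓘(ℝ, R2n n) x).symm ⁻¹' s ∩
      (extChartAt 𝓘(ℝ, R2n n) x).target, ENNReal.ofReal (Ω.chartDensity x z) := by
  have h := aemeasurable_extChartAt_symm (n := n) x
  rw [chartVolume, Measure.map_apply_of_aemeasurable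
    (h.mono_ac (withDensity_absolutelyContinuous _ _)) hs,
    withDensity_apply₀ _ (h.nullMeasurable hs), Measure.restrict_restrict₀ (h.nullMeasurable hs)]

theorem chartVolume_inter_source (Ω : SymplecticForm n M) (x : M) {s : Set M}
    (hs : MeasurableSet s) :
    Ω.chartVolume x (s ∩ (extChartAt 𝓘(ℝ, R2n n) x).source) = Ω.chartVolume x s := by
  rw [Ω.chartVolume_apply x (hs.inter (isOpen_extChartAt_source x).measurableSet),
    Ω.chartVolume_apply x hs]
  congr 2
  ext z
  constructor
  · rintro ⟨h1, h2⟩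
    exact ⟨h1.1, h2⟩
  · rintro ⟨h1, h2⟩
    exact ⟨⟨h1, (extChartAt 𝓘(ℝ, R2n n) x).map_target h2⟩, h2⟩

variable [IsManifold 𝓘(ℝ, R2n n) ∞ M]

/-- Symplectomorphisms map the symplectic volume measures of the charts to each other. -/
theorem IsSymplecto.chartVolume_image {Ω : SymplecticForm n M}
    {φ : M ≃ₘ⟮𝓘(ℝ, R2n n), 𝓘(ℝ, R2n n)⟯ M} (hφ : Ω.IsSymplecto φ) {x x' : M} {s : Set M}
    (hs : MeasurableSet s) (hsx : s ⊆ (extChartAt 𝓘(ℝ, R2n n) x).source)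
    (hsx' : φ '' s ⊆ (extChartAt 𝓘(ℝ, R2n n) x').source) :
    Ω.chartVolume x' (φ '' s) = Ω.chartVolume x s := by
  have hφs : MeasurableSet (φ '' s) :=
    φ.toHomeomorph.isClosedEmbedding.measurableEmbedding.measurableSet_image.2 hs
  rw [Ω.chartVolume_apply x hs, Ω.chartVolume_apply x' hφs]
  set e := extChartAt 𝓘(ℝ, R2n n) x
  set e' := extChartAt 𝓘(ℝ, R2n n) x'
  set F : R2n n → R2n n := fun z => e' (φ (e.symm z)) with hF
  set A := e.symm ⁻¹' s ∩ e.target with hA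
  have hAF : e'.symm ⁻¹' (φ '' s) ∩ e'.target = F '' A := by
    ext z
    constructor
    · rintro ⟨⟨y, hy, hyz⟩, hz⟩
      refine ⟨e y, ⟨?_, e.map_source (hsx hy)⟩, ?_⟩
      · rw [Set.mem_preimage, e.left_inv (hsx hy)]
        exact hy
      · rw [hF]
        dsimp only
        rw [e.left_inv (hsx hy), hyz, e'.right_inv hz]
    · rintro ⟨y, ⟨hy, hy'⟩, rfl⟩
      have h1 : φ (e.symm y) ∈ φ '' s := ⟨_, hy, rfl⟩
      refine ⟨?_, e'.map_source (hsx' h1)⟩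
      rw [Set.mem_preimage, e'.left_inv (hsx' h1)]
      exact h1
  have hAmeas : MeasurableSet A := by
    have h1 : MeasurableSet (Subtype.val '' ((fun z : e.target => e.symm z) ⁻¹' s)) :=
      MeasurableSet.subtype_image (isOpen_extChartAt_target x).measurableSet
        ((continuousOn_extChartAt_symm x).domRestrict.measurable hs)
    convert h1 using 1
    ext z
    simp [hA, and_comm]
  have hinj : Set.InjOn F A := by
    rintro y ⟨hy, hy'⟩ z ⟨hz, hz'⟩ hyz
    have h1 := e'.injOn (hsx' ⟨_, hy, rfl⟩) (hsx' ⟨_, hz, rfl⟩) hyz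
    exact e.symm.injOn hy' hz' (φ.injective h1)
  have hd : ∀ z ∈ A, _ := fun z hz => hφ.chartDensity_eq_mul (x := x) (x' := x') hz.2
    (hsx' ⟨_, hz.1, rfl⟩)
  rw [hAF, lintegral_image_eq_lintegral_abs_det_fderiv_mul volume hAmeas
    (fun z hz => (hd z hz).1.hasFDerivAt.hasFDerivWithinAt) hinj]
  refine setLIntegral_congr_fun hAmeas fun z hz => ?_
  rw [(hd z hz).2, ENNReal.ofReal_mul (abs_nonneg _)]

/-- The symplectic volume measures of two charts agree on the overlap. -/
theorem chartVolume_eq_of_subset (Ω : SymplecticForm n M) {x x' : M} {s : Set M}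
    (hs : MeasurableSet s) (hsx : s ⊆ (extChartAt 𝓘(ℝ, R2n n) x).source)
    (hsx' : s ⊆ (extChartAt 𝓘(ℝ, R2n n) x').source) :
    Ω.chartVolume x s = Ω.chartVolume x' s := by
  have := (IsSymplecto.refl Ω).chartVolume_image (x := x) (x' := x') hs hsx
    (by simpa using hsx')
  simpa using this.symm

variable [SecondCountableTopology M]

/-- The symplectic volume measure is given by the density of a chart on the domain of that chart:
the measures of countably many charts covering `M` are glued to a measure which bounds the measures
of all charts. -/
theorem volumeMeasure_eq_chartVolume (Ω : SymplecticForm n M) (x : M) {s : Set M}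
    (hs : MeasurableSet s) (hsx : s ⊆ (extChartAt 𝓘(ℝ, R2n n) x).source) :
    Ω.volumeMeasure s = Ω.chartVolume x s := by
  refine le_antisymm ?_ (Ω.chartVolume_le_volumeMeasure x s)
  obtain ⟨t, htc, ht⟩ := TopologicalSpace.countable_cover_nhds
    (fun y : M => extChartAt_source_mem_nhds (I := 𝓘(ℝ, R2n n)) y)
  obtain ⟨c, rfl⟩ := htc.exists_eq_range (by
    rw [Set.nonempty_iff_ne_empty]
    rintro rfl
    have : x ∈ (Set.univ : Set M) := trivial
    simp [← ht] at this)
  let D : ℕ → Set M := disjointed fun i => (extChartAt 𝓘(ℝ, R2n n) (c i)).source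
  have hD : ∀ i, MeasurableSet (D i) := fun i =>
    MeasurableSet.disjointed (fun i => (isOpen_extChartAt_source (c i)).measurableSet) i
  have hDsub : ∀ i, D i ⊆ (extChartAt 𝓘(ℝ, R2n n) (c i)).source := fun i =>
    disjointed_le _ i
  have hDdisj : Pairwise (Function.onFun Disjoint D) := disjoint_disjointed _
  have hDun : ⋃ i, D i = Set.univ := by
    rw [iUnion_disjointed, ← ht, Set.biUnion_range]
  have hsplit : ∀ (y : M) (s : Set M), MeasurableSet s →
      s ⊆ (extChartAt 𝓘(ℝ, R2n n) y).source →
      Ω.chartVolume y s = Measure.sum (fun i => (Ω.chartVolume (c i)).restrict (D i)) s := by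
    intro y s hs hsy
    rw [Measure.sum_apply _ hs]
    calc Ω.chartVolume y s = Ω.chartVolume y (⋃ i, s ∩ D i) := by
          rw [← Set.inter_iUnion, hDun, Set.inter_univ]
      _ = ∑' i, Ω.chartVolume y (s ∩ D i) :=
          measure_iUnion (fun i j hij => (hDdisj hij).mono Set.inter_subset_right
            Set.inter_subset_right) fun i => hs.inter (hD i)
      _ = _ := by
          refine tsum_congr fun i => ?_
          rw [Measure.restrict_apply hs]
          exact Ω.chartVolume_eq_of_subset (hs.inter (hD i))
            (Set.inter_subset_left.trans hsy) (Set.inter_subset_right.trans (hDsub i))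
  rw [hsplit x s hs hsx]
  suffices h : Ω.volumeMeasure ≤ Measure.sum fun i => (Ω.chartVolume (c i)).restrict (D i) from h s
  refine iSup_le fun y => Measure.le_iff.2 fun s hs => ?_
  rw [← Ω.chartVolume_inter_source y hs, hsplit y _
    (hs.inter (isOpen_extChartAt_source y).measurableSet) Set.inter_subset_right]
  exact measure_mono Set.inter_subset_left

/-- Symplectomorphisms preserve the symplectic volume: this is seen locally, in charts. -/
theorem IsSymplecto.measurePreserving {Ω : SymplecticForm n M}
    {φ : M ≃ₘ⟮𝓘(ℝ, R2n n), 𝓘(ℝ, R2n n)⟯ M} (hφ : Ω.IsSymplecto φ) :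
    MeasurePreserving φ Ω.volumeMeasure Ω.volumeMeasure := by
  set e : M ≃ᵐ M := φ.toHomeomorph.toMeasurableEquiv with he
  have heφ : ∀ s, e.symm ⁻¹' s = φ '' s := fun s => (φ.image_eq_preimage_symm s).symm
  suffices h : MeasurePreserving e.symm Ω.volumeMeasure Ω.volumeMeasure from
    h.symm e.symm
  refine ⟨e.symm.measurable, ?_⟩
  have hU : ∀ x : M, (extChartAt 𝓘(ℝ, R2n n) x).source ∩
      φ ⁻¹' (extChartAt 𝓘(ℝ, R2n n) (φ x)).source ∈ 𝓝 x := fun x =>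
    Filter.inter_mem (extChartAt_source_mem_nhds x)
      (φ.continuous.continuousAt.preimage_mem_nhds (extChartAt_source_mem_nhds (φ x)))
  obtain ⟨t, htc, ht⟩ := TopologicalSpace.countable_cover_nhds hU
  refine (Measure.ext_iff_of_biUnion_eq_univ htc ht).2 fun x _ => ?_
  ext s hs
  have hUm : MeasurableSet ((extChartAt 𝓘(ℝ, R2n n) x).source ∩
      φ ⁻¹' (extChartAt 𝓘(ℝ, R2n n) (φ x)).source) :=
    ((isOpen_extChartAt_source x).inter
      ((isOpen_extChartAt_source (φ x)).preimage φ.continuous)).measurableSet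
  rw [Measure.restrict_apply hs, Measure.restrict_apply hs,
    Measure.map_apply e.symm.measurable (hs.inter hUm), heφ]
  have h1 : s ∩ ((extChartAt 𝓘(ℝ, R2n n) x).source ∩
      φ ⁻¹' (extChartAt 𝓘(ℝ, R2n n) (φ x)).source) ⊆ (extChartAt 𝓘(ℝ, R2n n) x).source :=
    fun y hy => hy.2.1
  have h2 : φ '' (s ∩ ((extChartAt 𝓘(ℝ, R2n n) x).source ∩
      φ ⁻¹' (extChartAt 𝓘(ℝ, R2n n) (φ x)).source)) ⊆
        (extChartAt 𝓘(ℝ, R2n n) (φ x)).source := by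
    rintro _ ⟨y, hy, rfl⟩
    exact hy.2.2
  have h3 : MeasurableSet (φ '' (s ∩ ((extChartAt 𝓘(ℝ, R2n n) x).source ∩
      φ ⁻¹' (extChartAt 𝓘(ℝ, R2n n) (φ x)).source))) :=
    φ.toHomeomorph.isClosedEmbedding.measurableEmbedding.measurableSet_image.2
    (hs.inter hUm)
  rw [Ω.volumeMeasure_eq_chartVolume x (hs.inter hUm) h1,
    Ω.volumeMeasure_eq_chartVolume (φ x) h3 h2]
  exact hφ.chartVolume_image (hs.inter hUm) h1 h2

theorem isLocallyFiniteMeasure_volumeMeasure (Ω : SymplecticForm n M) :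
    IsLocallyFiniteMeasure Ω.volumeMeasure := by
  refine ⟨fun x => ?_⟩
  set e := extChartAt 𝓘(ℝ, R2n n) x
  obtain ⟨K, hK, hKs, hKc⟩ := local_compact_nhds
    ((isOpen_extChartAt_target x).mem_nhds (mem_extChartAt_target (I := 𝓘(ℝ, R2n n)) x))
  have h1 : e.source ∩ e ⁻¹' interior K ∈ 𝓝 x :=
    Filter.inter_mem (extChartAt_source_mem_nhds x)
      ((continuousAt_extChartAt x).preimage_mem_nhds (interior_mem_nhds.2 hK))
  have hop : IsOpen (e.source ∩ e ⁻¹' interior K) :=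
    (continuousOn_extChartAt x).isOpen_inter_preimage (isOpen_extChartAt_source x) isOpen_interior
  refine ⟨_, h1, ?_⟩
  rw [Ω.volumeMeasure_eq_chartVolume x hop.measurableSet Set.inter_subset_left,
    Ω.chartVolume_apply x hop.measurableSet]
  have h2 : e.symm ⁻¹' (e.source ∩ e ⁻¹' interior K) ∩ e.target ⊆ K := by
    rintro z ⟨hz, hz'⟩
    have := hz.2
    rw [Set.mem_preimage, e.right_inv hz'] at this
    exact interior_subset this
  refine (lintegral_mono_set h2).trans_lt ?_
  have h3 : IntegrableOn (Ω.chartDensity x) K :=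
    ((Ω.continuousOn_chartDensity x).mono hKs).integrableOn_compact hKc
  exact h3.lintegral_lt_top

theorem isFiniteMeasure_volumeMeasure [CompactSpace M] (Ω : SymplecticForm n M) :
    IsFiniteMeasure Ω.volumeMeasure :=
  have := Ω.isLocallyFiniteMeasure_volumeMeasure
  inferInstance

omit [SecondCountableTopology M] in
theorem volumeMeasure_ne_zero [Nonempty M] (Ω : SymplecticForm n M) : Ω.volumeMeasure ≠ 0 := by
  intro h
  obtain ⟨x⟩ := ‹Nonempty M›
  have h1 : Ω.chartVolume x Set.univ = 0 := by
    have := Ω.chartVolume_le_volumeMeasure x Set.univ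
    simpa [h] using this
  rw [Ω.chartVolume_apply x MeasurableSet.univ, Set.preimage_univ, Set.univ_inter] at h1
  have hpos : 0 < volume (extChartAt 𝓘(ℝ, R2n n) x).target :=
    (isOpen_extChartAt_target x).measure_pos _ ⟨_, mem_extChartAt_target x⟩
  have hmeas : AEMeasurable (fun z => ENNReal.ofReal (Ω.chartDensity x z))
      ((volume : Measure (R2n n)).restrict (extChartAt 𝓘(ℝ, R2n n) x).target) :=
    ((Ω.continuousOn_chartDensity x).aemeasurable
      (isOpen_extChartAt_target x).measurableSet).ennreal_ofReal
  rw [lintegral_eq_zero_iff' hmeas] at h1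
  have h2 : ∀ᵐ _ ∂((volume : Measure (R2n n)).restrict (extChartAt 𝓘(ℝ, R2n n) x).target),
      False := by
    filter_upwards [h1, ae_restrict_mem (isOpen_extChartAt_target x).measurableSet] with z hz hzt
    have := Ω.chartDensity_pos hzt
    simp only [Pi.zero_apply, ENNReal.ofReal_eq_zero] at hz
    linarith
  rw [Filter.eventually_false_iff_eq_bot, ae_eq_bot, Measure.restrict_eq_zero] at h2
  exact hpos.ne' h2

end SymplecticForm

/-! ### The calculus of Hamiltonian isotopies -/

namespace SymplecticForm

variable {n : ℕ} {M : Type*} [TopologicalSpace M] [ChartedSpace (R2n n) M]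
  {Ω : SymplecticForm n M} {φ ψ : ℝ → (M ≃ₘ⟮𝓘(ℝ, R2n n), 𝓘(ℝ, R2n n)⟯ M)} {H K : ℝ → M → ℝ}

theorem IsSmoothFamily.trans (hψ : IsSmoothFamily ψ) (hφ : IsSmoothFamily φ) :
    IsSmoothFamily (fun t => (ψ t).trans (φ t)) :=
  ⟨hφ.1.comp (contMDiff_fst.prodMk hψ.1), hψ.2.comp (contMDiff_fst.prodMk hφ.2)⟩

theorem IsSmoothFamily.reparam (hφ : IsSmoothFamily φ) {τ : ℝ → ℝ} (hτ : ContDiff ℝ ∞ τ) :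
    IsSmoothFamily (fun t => φ (τ t)) :=
  have h : ContMDiff (𝓘(ℝ, ℝ).prod 𝓘(ℝ, R2n n)) (𝓘(ℝ, ℝ).prod 𝓘(ℝ, R2n n)) ∞
      (fun p : ℝ × M => (τ p.1, p.2)) :=
    (hτ.contMDiff.comp contMDiff_fst).prodMk contMDiff_snd
  ⟨hφ.1.comp h, hφ.2.comp h⟩

theorem IsSmoothFamily.const (c : M ≃ₘ⟮𝓘(ℝ, R2n n), 𝓘(ℝ, R2n n)⟯ M) :
    IsSmoothFamily (fun _ : ℝ => c) :=
  ⟨c.contMDiff.comp contMDiff_snd, c.symm.contMDiff.comp contMDiff_snd⟩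

theorem velocity_trans (hψ : IsSmoothFamily ψ) (hφ : IsSmoothFamily φ) (t : ℝ) (y : M) :
    velocity (fun t => (ψ t).trans (φ t)) t y = velocity φ t (ψ t y) +
      mfderiv 𝓘(ℝ, R2n n) 𝓘(ℝ, R2n n) (φ t) (ψ t y) (velocity ψ t y) := by
  have hA : MDifferentiableAt (𝓘(ℝ, ℝ).prod 𝓘(ℝ, R2n n)) 𝓘(ℝ, R2n n)
      (fun p : ℝ × M => φ p.1 p.2) (t, ψ t y) := hφ.1.mdifferentiableAt (by simp)
  have h1 := (HasMFDerivAt.comp t hA.hasMFDerivAt ((hasMFDerivAt_id (I := 𝓘(ℝ, ℝ)) t).prodMk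
    (((hψ.contMDiff_curve y).mdifferentiableAt (x := t) (by simp)).hasMFDerivAt))).mfderiv
  refine (congrArg (fun L : ℝ →L[ℝ] R2n n => L 1) h1).trans ?_
  exact mfderiv_prod_eq_add_apply hA

theorem velocity_reparam (hφ : IsSmoothFamily φ) {τ : ℝ → ℝ} (hτ : ContDiff ℝ ∞ τ) (t : ℝ)
    (y : M) : velocity (fun t => φ (τ t)) t y = deriv τ t • velocity φ (τ t) y := by
  have hd : HasDerivAt τ (deriv τ t) t := (hτ.differentiable (by simp) t).hasDerivAt
  have h1 := (HasMFDerivAt.comp t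
    (((hφ.contMDiff_curve y).mdifferentiableAt (x := τ t) (by simp)).hasMFDerivAt)
    hd.hasFDerivAt.hasMFDerivAt).mfderiv
  refine (congrArg (fun L : ℝ →L[ℝ] R2n n => L 1) h1).trans ?_
  exact comp_toSpanSingleton_one _ _

/-- The pointwise product `φ t ∘ ψ t` of two Hamiltonian isotopies, the first of which is
symplectic, is generated by `H t + K t ∘ (φ t)⁻¹`. -/
theorem Generates.trans (hψ : IsSmoothFamily ψ) (hφ : IsSmoothFamily φ) (hK : Ω.Generates K ψ)
    (hH : Ω.Generates H φ) (hs : ∀ t, Ω.IsSymplecto (φ t)) :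
    Ω.Generates (fun t y => H t y + K t ((φ t).symm y)) (fun t => (ψ t).trans (φ t)) := by
  refine ⟨hH.1.add (hK.1.comp (contMDiff_fst.prodMk hφ.2)), fun t y v => ?_⟩
  set x := ψ t y with hx
  set p := φ t x with hp
  have hpx : (φ t).symm p = x := (φ t).symm_apply_apply x
  have hφd : MDifferentiableAt 𝓘(ℝ, R2n n) 𝓘(ℝ, R2n n) (φ t) x :=
    (φ t).mdifferentiable (by simp) _
  have hφd' : MDifferentiableAt 𝓘(ℝ, R2n n) 𝓘(ℝ, R2n n) (φ t).symm p :=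
    (φ t).symm.mdifferentiable (by simp) _
  have hKd : MDifferentiableAt 𝓘(ℝ, R2n n) 𝓘(ℝ, ℝ) (K t) x :=
    (hK.contMDiff_slice t).mdifferentiable (by simp) _
  have hHd : MDifferentiableAt 𝓘(ℝ, R2n n) 𝓘(ℝ, ℝ) (H t) p :=
    (hH.contMDiff_slice t).mdifferentiable (by simp) _
  let u : R2n n := mfderiv 𝓘(ℝ, R2n n) 𝓘(ℝ, R2n n) (φ t).symm p v
  let D : R2n n →L[ℝ] R2n n := mfderiv 𝓘(ℝ, R2n n) 𝓘(ℝ, R2n n) (φ t) x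
  let L : R2n n →L[ℝ] ℝ := mfderiv 𝓘(ℝ, R2n n) 𝓘(ℝ, ℝ) (K t) x
  have hD : ∀ x', x' = x → HasMFDerivAt 𝓘(ℝ, R2n n) 𝓘(ℝ, R2n n) (φ t) x' D := by
    rintro _ rfl
    exact hφd.hasMFDerivAt
  have hL : ∀ x', x' = x → HasMFDerivAt 𝓘(ℝ, R2n n) 𝓘(ℝ, ℝ) (K t) x' L := by
    rintro _ rfl
    exact hKd.hasMFDerivAt
  have huv : D u = v := by
    have h1 := (HasMFDerivAt.comp p (hD _ hpx) hφd'.hasMFDerivAt).mfderiv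
    have h2 : φ t ∘ (φ t).symm = id := funext fun z => (φ t).apply_symm_apply z
    rw [h2, mfderiv_id] at h1
    exact (congrArg (fun L : R2n n →L[ℝ] R2n n => L v) h1).symm
  have hdK : mfderiv 𝓘(ℝ, R2n n) 𝓘(ℝ, ℝ) (fun z => K t ((φ t).symm z)) p v = L u := by
    have h1 := (HasMFDerivAt.comp p (hL _ hpx) hφd'.hasMFDerivAt).mfderiv
    exact congrArg (fun L : R2n n →L[ℝ] ℝ => L v) h1
  have hKd' : MDifferentiableAt 𝓘(ℝ, R2n n) 𝓘(ℝ, ℝ) (fun z => K t ((φ t).symm z)) p :=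
    ((hK.contMDiff_slice t).comp (φ t).symm.contMDiff).mdifferentiable (by simp) _
  let L' : R2n n →L[ℝ] ℝ := mfderiv 𝓘(ℝ, R2n n) 𝓘(ℝ, ℝ) (H t) p
  have hsum : mfderiv 𝓘(ℝ, R2n n) 𝓘(ℝ, ℝ) (fun z => H t z + K t ((φ t).symm z)) p v =
      L' v + L u := by
    rw [← hdK]
    exact congrArg (fun L : R2n n →L[ℝ] ℝ => L v) (mfderiv_add hHd hKd')
  refine Eq.trans ?_ hsum.symm
  have hΩ : Ω.form p ![D (velocity ψ t y), v] = Ω.form x ![velocity ψ t y, u] := by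
    rw [← hs t x, ← huv]
    refine congrArg (Ω.form p) (funext fun i => ?_)
    fin_cases i <;> rfl
  refine Eq.trans ?_ (congrArg₂ (fun a b : ℝ => a + b) (hH.2 t x v) (hΩ.trans (hK.2 t y u)))
  have hv := velocity_trans hψ hφ t y
  refine (congrArg (fun w : R2n n => (Ω.form p : (R2n n) [⋀^Fin 2]→L[ℝ] ℝ) ![w, v]) hv).trans ?_
  exact (ContinuousAlternatingMap.toBilin (Ω.form p)).map_add₂ _ _ _

theorem Generates.reparam (hφ : IsSmoothFamily φ) (hH : Ω.Generates H φ) {τ : ℝ → ℝ}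
    (hτ : ContDiff ℝ ∞ τ) :
    Ω.Generates (fun t y => deriv τ t * H (τ t) y) (fun t => φ (τ t)) := by
  have hτ' : ContDiff ℝ ∞ (deriv τ) := (contDiff_infty_iff_deriv.1 hτ).2
  refine ⟨(hτ'.contMDiff.comp contMDiff_fst).mul
    (hH.1.comp ((hτ.contMDiff.comp contMDiff_fst).prodMk contMDiff_snd)), fun t y v => ?_⟩
  have hd : mfderiv 𝓘(ℝ, R2n n) 𝓘(ℝ, ℝ) (fun y => deriv τ t * H (τ t) y) (φ (τ t) y)
      = deriv τ t • mfderiv 𝓘(ℝ, R2n n) 𝓘(ℝ, ℝ) (H (τ t)) (φ (τ t) y) :=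
    const_smul_mfderiv ((hH.contMDiff_slice _).mdifferentiableAt (by simp)) _
  rw [hd, velocity_reparam hφ hτ]
  exact (alternating_smul_left _ _ _ _).trans
    (congrArg (fun r : ℝ => deriv τ t * r) (hH.2 (τ t) y v))

theorem Generates.const_trans (hH : Ω.Generates H φ)
    (c : M ≃ₘ⟮𝓘(ℝ, R2n n), 𝓘(ℝ, R2n n)⟯ M) : Ω.Generates H (fun t => c.trans (φ t)) :=
  ⟨hH.1, fun t y v => hH.2 t (c y) v⟩

variable [IsManifold 𝓘(ℝ, R2n n) ∞ M]

theorem Generates.mem_ham (hψ : IsSmoothFamily ψ) (hH : Ω.Generates H ψ) (h0 : ∀ y, ψ 0 y = y)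
    (s : ℝ) : ψ s ∈ Ω.Ham := by
  have hτ : ContDiff ℝ ∞ (fun t : ℝ => s * t) := contDiff_const.mul contDiff_id
  refine ⟨hH.isSymplecto hψ h0 s, fun t => ψ (s * t), _, hψ.reparam hτ, hH.reparam hψ hτ, ?_, ?_⟩
  · simpa using h0
  · simp

theorem trans_mem_ham {f g : M ≃ₘ⟮𝓘(ℝ, R2n n), 𝓘(ℝ, R2n n)⟯ M} (hf : f ∈ Ω.Ham)
    (hg : g ∈ Ω.Ham) : f.trans g ∈ Ω.Ham := by
  obtain ⟨hfs, ψ, K, hψ, hK, hψ0, rfl⟩ := hf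
  obtain ⟨hgs, φ, H, hφ, hH, hφ0, rfl⟩ := hg
  exact ⟨hfs.trans hgs, _, _, hψ.trans hφ, hK.trans hψ hφ hH (hH.isSymplecto hφ hφ0),
    fun y => by simp [hψ0, hφ0], rfl⟩

/-- The inverse of a Hamiltonian diffeomorphism is joined to the identity by a smooth path of
Hamiltonian diffeomorphisms: run a flow ending at the diffeomorphism backwards. -/
theorem exists_path_symm {f : M ≃ₘ⟮𝓘(ℝ, R2n n), 𝓘(ℝ, R2n n)⟯ M} (hf : f ∈ Ω.Ham) :
    ∃ c : ℝ → (M ≃ₘ⟮𝓘(ℝ, R2n n), 𝓘(ℝ, R2n n)⟯ M), IsSmoothFamily c ∧ (∀ s, c s ∈ Ω.Ham) ∧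
      (∀ y, c 0 y = y) ∧ c 1 = f.symm := by
  obtain ⟨-, ψ, K, hψ, hK, hψ0, rfl⟩ := hf
  have hτ : ContDiff ℝ ∞ (fun t : ℝ => 1 - t) := contDiff_const.sub contDiff_id
  have hc := (IsSmoothFamily.const (ψ 1).symm).trans (hψ.reparam hτ)
  have h0 : ∀ y, ((ψ 1).symm.trans (ψ (1 - 0))) y = y := fun y => by simp
  refine ⟨fun s => (ψ 1).symm.trans (ψ (1 - s)), hc,
    ((hK.reparam hψ hτ).const_trans _).mem_ham hc h0, h0, ?_⟩
  ext y
  simp [hψ0]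

omit [IsManifold 𝓘(ℝ, R2n n) ∞ M] in
theorem generates_const (Ω : SymplecticForm n M) (c : M ≃ₘ⟮𝓘(ℝ, R2n n), 𝓘(ℝ, R2n n)⟯ M) :
    Ω.Generates (fun _ _ => 0) (fun _ => c) := by
  refine ⟨contMDiff_const, fun t y v => ?_⟩
  have hv : velocity (fun _ => c) t y = 0 :=
    congrArg (fun L : ℝ →L[ℝ] R2n n => L 1) (mfderiv_const (c := c y))
  rw [hv, mfderiv_const]
  exact (Ω.form (c y)).map_coord_zero 0 rfl

omit [IsManifold 𝓘(ℝ, R2n n) ∞ M] in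
theorem id_mem_ham (Ω : SymplecticForm n M) : Diffeomorph.refl 𝓘(ℝ, R2n n) M ∞ ∈ Ω.Ham := by
  exact ⟨IsSymplecto.refl Ω, fun _ => Diffeomorph.refl 𝓘(ℝ, R2n n) M ∞, fun _ _ => 0,
    IsSmoothFamily.const _, generates_const Ω _, fun _ => rfl, rfl⟩

end SymplecticForm

/-! ### Products and reparametrizations of loops -/

/-- A smooth self-map `τ` of the circle of degree one, given by its lift to `ℝ`, which is constant
on a half circle: at each time `τ` or its translate by half a turn is at the base point. -/
theorem exists_contDiff_degree_one_half_constant : ∃ τ : ℝ → ℝ, ContDiff ℝ ∞ τ ∧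
    (∀ t, τ (t + 1) = τ t + 1) ∧
    ∀ t, (∃ m : ℤ, τ t = m) ∨ ∃ m : ℤ, τ (t - 1 / 2) = m := by
  let b : ℝ → ℝ := fun t => expNegInvGlue (Real.sin (2 * Real.pi * t))
  have hb : ContDiff ℝ ∞ b :=
    expNegInvGlue.contDiff.comp (Real.contDiff_sin.comp (contDiff_const.mul contDiff_id))
  have hbper : Function.Periodic b 1 := by
    intro t
    simp only [b, mul_add, mul_one, Real.sin_add_two_pi]
  have hint : ∀ u v, IntervalIntegrable b volume u v := fun u v =>
    hb.continuous.intervalIntegrable u v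
  let B : ℝ → ℝ := fun t => ∫ s in (0 : ℝ)..t, b s
  have hBd : ∀ t, HasDerivAt B (b t) t := fun t =>
    (hb.continuous.integral_hasStrictDerivAt 0 t).hasDerivAt
  have hB : ContDiff ℝ ∞ B := by
    rw [contDiff_infty_iff_deriv]
    refine ⟨fun t => (hBd t).differentiableAt, ?_⟩
    rwa [funext fun t => (hBd t).deriv]
  have hB1 : ∀ t, B (t + 1) = B t + B 1 := by
    intro t
    have h1 := hbper.intervalIntegral_add_eq t 0
    have h2 := intervalIntegral.integral_add_adjacent_intervals (hint 0 t) (hint t (t + 1))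
    rw [zero_add] at h1
    rw [h1] at h2
    exact h2.symm
  -- The sine is non-positive on the second half of the period, so `B` is constant there.
  have hBhalf : ∀ r ∈ Set.Icc (1 / 2 : ℝ) 1, B r = B 1 := by
    intro r hr
    have h2 := intervalIntegral.integral_add_adjacent_intervals (hint 0 r) (hint r 1)
    have h3 : ∫ s in r..1, b s = 0 := by
      refine (intervalIntegral.integral_congr (g := fun _ => 0) fun s hs => ?_).trans (by simp)
      rw [Set.uIcc_of_le hr.2] at hs
      refine expNegInvGlue.zero_of_nonpos ?_
      rw [← Real.sin_sub_two_pi]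
      refine Real.sin_nonpos_of_nonpos_of_neg_pi_le ?_ ?_
      · nlinarith [Real.pi_pos, hs.2]
      · nlinarith [Real.pi_pos, hs.1, hr.1]
    rw [h3, add_zero] at h2
    exact h2
  have hc : 0 < B 1 := by
    rw [← hBhalf (1 / 2) ⟨le_rfl, by norm_num⟩]
    refine intervalIntegral.intervalIntegral_pos_of_pos_on (hint _ _) (fun s hs => ?_) (by norm_num)
    refine expNegInvGlue.pos_of_pos (Real.sin_pos_of_pos_of_lt_pi ?_ ?_)
    · nlinarith [Real.pi_pos, hs.1]
    · nlinarith [Real.pi_pos, hs.2]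
  have hτ1 : ∀ t, B (t + 1) / B 1 = B t / B 1 + 1 := by
    intro t
    rw [hB1, add_div, div_self hc.ne']
  have hτm : ∀ (m : ℤ) t, B (t + m) / B 1 = B t / B 1 + m := by
    intro m t
    have hp : Function.Periodic (fun t => B t / B 1 - t) 1 := by
      intro t
      dsimp only
      rw [hτ1]
      ring
    have := hp.int_mul m t
    simp only [mul_one] at this
    linarith
  refine ⟨fun t => B t / B 1, hB.div_const _, hτ1, fun t => ?_⟩
  have ht : t = Int.fract t + (⌊t⌋ : ℤ) := (Int.fract_add_floor t).symm
  have h0 := Int.fract_nonneg t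
  have h1 := Int.fract_lt_one t
  rcases le_total (1 / 2) (Int.fract t) with h | h
  · left
    refine ⟨⌊t⌋ + 1, ?_⟩
    dsimp only
    conv_lhs => rw [ht]
    rw [hτm, hBhalf _ ⟨h, h1.le⟩, div_self hc.ne']
    push_cast
    ring
  · right
    refine ⟨⌊t⌋, ?_⟩
    have h2 : t - 1 / 2 = (Int.fract t + 1 / 2) + (⌊t⌋ - 1 : ℤ) := by
      push_cast
      linarith
    dsimp only
    rw [h2, hτm, hBhalf _ ⟨by linarith, by linarith⟩, div_self hc.ne']
    simp

namespace SymplecticForm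

variable {n : ℕ} {M : Type*} [TopologicalSpace M] [ChartedSpace (R2n n) M]
  [MeasurableSpace M] {Ω : SymplecticForm n M}
  {φ ψ : ℝ → (M ≃ₘ⟮𝓘(ℝ, R2n n), 𝓘(ℝ, R2n n)⟯ M)} {H K : ℝ → M → ℝ}

theorem IsNormalizedHamiltonian.reparam (hφ : IsSmoothFamily φ)
    (hH : Ω.IsNormalizedHamiltonian H φ) {τ : ℝ → ℝ} (hτ : ContDiff ℝ ∞ τ) {m : ℤ}
    (hm : ∀ t, τ (t + 1) = τ t + m) :
    Ω.IsNormalizedHamiltonian (fun t y => deriv τ t * H (τ t) y) (fun t => φ (τ t)) := by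
  refine ⟨hH.1.reparam hφ hτ, fun t => ?_, fun t => ?_⟩
  · have h1 : deriv τ (t + 1) = deriv τ t := by
      rw [← deriv_comp_add_const, funext hm, deriv_add_const]
    have h2 : H (τ t + m) = H (τ t) := by simpa using hH.2.1.int_mul m (τ t)
    funext y
    dsimp only
    rw [h1, hm, h2]
  · rw [integral_const_mul, hH.2.2, mul_zero]

variable [BorelSpace M] [IsManifold 𝓘(ℝ, R2n n) ∞ M] [SecondCountableTopology M] [CompactSpace M]

theorem IsNormalizedHamiltonian.trans (hψ : IsSmoothFamily ψ) (hφ : IsSmoothFamily φ)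
    (hK : Ω.IsNormalizedHamiltonian K ψ) (hH : Ω.IsNormalizedHamiltonian H φ)
    (hs : ∀ t, Ω.IsSymplecto (φ t)) (hp : Function.Periodic φ 1) :
    Ω.IsNormalizedHamiltonian (fun t y => H t y + K t ((φ t).symm y))
      (fun t => (ψ t).trans (φ t)) := by
  have := Ω.isFiniteMeasure_volumeMeasure
  refine ⟨hK.1.trans hψ hφ hH.1 hs, fun t => ?_, fun t => ?_⟩
  · funext y
    dsimp only
    rw [hH.2.1, hK.2.1, hp]
  · have hHc : Continuous (H t) := (hH.1.contMDiff_slice t).continuous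
    have hKc : Continuous (fun y => K t ((φ t).symm y)) :=
      (hK.1.contMDiff_slice t).continuous.comp (φ t).symm.continuous
    rw [integral_add (hHc.integrable_of_hasCompactSupport (.of_compactSpace _))
      (hKc.integrable_of_hasCompactSupport (.of_compactSpace _)), hH.2.2 t, zero_add,
      ← (hs t).measurePreserving.integral_comp
        (φ t).toHomeomorph.isClosedEmbedding.measurableEmbedding]
    simpa using hK.2.2 t

end SymplecticForm

namespace HamLoop

variable {n : ℕ} {M : Type*} [TopologicalSpace M] [ChartedSpace (R2n n) M]
  [MeasurableSpace M] {Ω : SymplecticForm n M}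

theorem ext_apply {g h : HamLoop Ω} (hgh : ∀ t y, g.toFun t y = h.toFun t y) : g = h := by
  have : g.toFun = h.toFun := funext fun t => Diffeomorph.ext (hgh t)
  cases g
  cases h
  congr

theorem toFun_add_int (h : HamLoop Ω) (t : ℝ) (m : ℤ) : h.toFun (t + m) = h.toFun t := by
  simpa using h.periodic.int_mul m t

/-- The composition of a loop with a self-map of the circle of degree `m`, given by its lift
to `ℝ`. -/
def reparam (h : HamLoop Ω) (τ : ℝ → ℝ) (hτ : ContDiff ℝ ∞ τ) (m : ℤ)
    (hm : ∀ t, τ (t + 1) = τ t + m) : HamLoop Ω where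
  toFun t := h.toFun (τ t)
  periodic t := by dsimp only; rw [hm, h.toFun_add_int]
  smooth := h.smooth.reparam hτ
  mem_ham t := h.mem_ham _
  exists_hamiltonian :=
    let ⟨_, hH⟩ := h.exists_hamiltonian
    ⟨_, hH.reparam h.smooth hτ hm⟩

/-- Self-maps of the circle of equal degree are homotopic through the linear interpolation of
their lifts. -/
theorem smoothHomotopic_reparam (h : HamLoop Ω) {τ σ : ℝ → ℝ} (hτ : ContDiff ℝ ∞ τ)
    (hσ : ContDiff ℝ ∞ σ) {m : ℤ} (hτm : ∀ t, τ (t + 1) = τ t + m)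
    (hσm : ∀ t, σ (t + 1) = σ t + m) :
    SmoothHomotopic (h.reparam τ hτ m hτm) (h.reparam σ hσ m hσm) := by
  refine ⟨fun s => h.reparam (fun t => τ t + s * (σ t - τ t))
    (hτ.add (contDiff_const.mul (hσ.sub hτ))) m (fun t => by rw [hτm, hσm]; ring), ?_, ?_, ?_⟩
  · exact ext_apply fun t y => by simp [reparam]
  · exact ext_apply fun t y => by simp [reparam]
  · have h1 : ContDiff ℝ ∞ (fun p : ℝ × ℝ => τ p.2 + p.1 * (σ p.2 - τ p.2)) := by fun_prop
    have h2 : ContMDiff (𝓘(ℝ, ℝ).prod (𝓘(ℝ, ℝ).prod 𝓘(ℝ, R2n n))) 𝓘(ℝ, ℝ × ℝ) ∞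
        (fun p : ℝ × ℝ × M => (p.1, p.2.1)) :=
      contMDiff_fst.prodMk_space (contMDiff_fst.comp contMDiff_snd)
    exact h.smooth.1.comp ((h1.contMDiff.comp h2).prodMk (contMDiff_snd.comp contMDiff_snd))

/-- The constant loop at a Hamiltonian diffeomorphism. -/
def const (c : M ≃ₘ⟮𝓘(ℝ, R2n n), 𝓘(ℝ, R2n n)⟯ M) (hc : c ∈ Ω.Ham) : HamLoop Ω where
  toFun _ := c
  periodic _ := rfl
  smooth := SymplecticForm.IsSmoothFamily.const c
  mem_ham _ := hc
  exists_hamiltonian := ⟨fun _ _ => 0, Ω.generates_const c, fun _ => rfl, fun _ => by simp⟩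

variable [BorelSpace M] [IsManifold 𝓘(ℝ, R2n n) ∞ M] [SecondCountableTopology M] [CompactSpace M]

/-- The pointwise product `t ↦ g t ∘ h t` of two loops. -/
def mul (g h : HamLoop Ω) : HamLoop Ω where
  toFun t := (h.toFun t).trans (g.toFun t)
  periodic t := by dsimp only; rw [h.periodic, g.periodic]
  smooth := h.smooth.trans g.smooth
  mem_ham t := SymplecticForm.trans_mem_ham (h.mem_ham t) (g.mem_ham t)
  exists_hamiltonian :=
    let ⟨_, hK⟩ := h.exists_hamiltonian
    let ⟨_, hH⟩ := g.exists_hamiltonian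
    ⟨_, hK.trans h.smooth g.smooth hH (fun t => (g.mem_ham t).1) g.periodic⟩

@[simp]
theorem mul_apply (g h : HamLoop Ω) (t : ℝ) (y : M) :
    (g.mul h).toFun t y = g.toFun t (h.toFun t y) := rfl

theorem SmoothHomotopic.mul_right {g g' : HamLoop Ω} (hg : SmoothHomotopic g g')
    (h : HamLoop Ω) : SmoothHomotopic (g.mul h) (g'.mul h) := by
  obtain ⟨K, rfl, rfl, hK⟩ := hg
  refine ⟨fun s => (K s).mul h, rfl, rfl, ?_⟩
  exact hK.comp (contMDiff_fst.prodMk ((contMDiff_fst.comp contMDiff_snd).prodMk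
    (h.smooth.1.comp contMDiff_snd)))

theorem SmoothHomotopic.mul_left (g : HamLoop Ω) {h h' : HamLoop Ω}
    (hh : SmoothHomotopic h h') : SmoothHomotopic (g.mul h) (g.mul h') := by
  obtain ⟨K, rfl, rfl, hK⟩ := hh
  refine ⟨fun s => g.mul (K s), rfl, rfl, ?_⟩
  exact g.smooth.1.comp ((contMDiff_fst.comp contMDiff_snd).prodMk hK)

end HamLoop

namespace HamPi1

variable {n : ℕ} {M : Type*} [TopologicalSpace M] [ChartedSpace (R2n n) M]
  [MeasurableSpace M] {Ω : SymplecticForm n M}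

/-- The class of a loop. -/
def mk (h : HamLoop Ω) : HamPi1 Ω := Quot.mk _ h

theorem mk_eq_of_smoothHomotopic {g h : HamLoop Ω} (hgh : HamLoop.SmoothHomotopic g h) :
    mk g = mk h := Quot.sound hgh

theorem npow_mk (h : HamLoop Ω) (k : ℕ) : (mk h).npow k = mk (h.iterate k) := rfl

variable [BorelSpace M] [IsManifold 𝓘(ℝ, R2n n) ∞ M] [SecondCountableTopology M] [CompactSpace M]

/-- The product of `π₁(Ham(M, Ω))`, induced by the pointwise product of loops. -/
def mul (γ δ : HamPi1 Ω) : HamPi1 Ω :=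
  Quot.map₂ HamLoop.mul (fun g _ _ hh => hh.mul_left g) (fun _ _ h hg => hg.mul_right h) γ δ

theorem mul_mk (g h : HamLoop Ω) : (mk g).mul (mk h) = mk (g.mul h) := rfl

/-- A loop is freely homotopic to a loop based at the identity, because `Ham(M, Ω)` is smoothly
path connected. -/
theorem exists_mk_eq_based (h : HamLoop Ω) :
    ∃ g : HamLoop Ω, (∀ y, g.toFun 0 y = y) ∧ mk g = mk h := by
  obtain ⟨c, hc, hcham, hc0, hc1⟩ := SymplecticForm.exists_path_symm (h.mem_ham 0)
  -- `g t = h t ∘ (h 0)⁻¹` is joined to `h` by the loops `h t ∘ c s`.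
  refine ⟨h.mul (.const (c 1) (hcham 1)), fun y => ?_, ?_⟩
  · rw [HamLoop.mul_apply]
    simp [HamLoop.const, hc1]
  · refine (mk_eq_of_smoothHomotopic ⟨fun s => h.mul (.const (c s) (hcham s)), ?_, rfl, ?_⟩).symm
    · exact HamLoop.ext_apply fun t y => by simp [HamLoop.const, hc0]
    · exact h.smooth.1.comp ((contMDiff_fst.comp contMDiff_snd).prodMk
        (hc.1.comp (contMDiff_fst.prodMk (contMDiff_snd.comp contMDiff_snd))))

/-- The pointwise product of a based loop with its `k`-fold iterate is its `(k + 1)`-fold iterate: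
let the two factors move one after the other. -/
theorem mk_mul_mk_iterate (g : HamLoop Ω) (hg : ∀ y, g.toFun 0 y = y) (k : ℕ) :
    (mk g).mul (mk (g.iterate k)) = mk (g.iterate (k + 1)) := by
  obtain ⟨τ, hτ, hτ1, hτint⟩ := exists_contDiff_degree_one_half_constant
  have hgm : ∀ (m : ℤ) y, g.toFun m y = y := by
    intro m y
    have := g.toFun_add_int 0 m
    rw [zero_add] at this
    rw [this, hg]
  have hid : ∀ j : ℕ, g.iterate j = g.reparam (fun t => j * t) (contDiff_const.mul contDiff_id) j
      (fun t => by push_cast; ring) := fun j => rfl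
  have hone : g = g.reparam (fun t => t) contDiff_id 1 (fun t => by push_cast; ring) := rfl
  have hρ : ContDiff ℝ ∞ (fun t => k * τ (t - 1 / 2)) := by fun_prop
  have hρ1 : ∀ t, (k : ℝ) * τ (t + 1 - 1 / 2) = k * τ (t - 1 / 2) + (k : ℤ) := by
    intro t
    rw [show t + 1 - 1 / 2 = t - 1 / 2 + 1 by ring, hτ1]
    push_cast
    ring
  have hτ1' : ∀ t, τ (t + 1) = τ t + (1 : ℤ) := by simpa using hτ1
  have h1 : mk g = mk (g.reparam τ hτ 1 hτ1') := by
    conv_lhs => rw [hone]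
    exact mk_eq_of_smoothHomotopic (g.smoothHomotopic_reparam _ _ _ _)
  have h2 : mk (g.iterate k) = mk (g.reparam _ hρ k hρ1) := by
    rw [hid]
    exact mk_eq_of_smoothHomotopic (g.smoothHomotopic_reparam _ _ _ _)
  have hsum : ∀ t, τ (t + 1) + k * τ (t + 1 - 1 / 2) =
      τ t + k * τ (t - 1 / 2) + ((k + 1 : ℕ) : ℤ) := by
    intro t
    rw [hρ1, hτ1]
    push_cast
    ring
  have h3 : mk (g.iterate (k + 1)) = mk (g.reparam _ (hτ.add hρ) _ hsum) := by
    rw [hid]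
    exact mk_eq_of_smoothHomotopic (g.smoothHomotopic_reparam _ _ _ _)
  rw [h1, h2, h3, mul_mk]
  congr 1
  refine HamLoop.ext_apply fun t y => ?_
  change g.toFun (τ t) (g.toFun (k * τ (t - 1 / 2)) y) = g.toFun (τ t + k * τ (t - 1 / 2)) y
  -- At each time one of the two factors is the identity, and its parameter is an integer.
  rcases hτint t with ⟨m, hm⟩ | ⟨m, hm⟩
  · rw [hm, hgm, add_comm, g.toFun_add_int]
  · have h4 : (k : ℝ) * τ (t - 1 / 2) = ((k * m : ℤ) : ℝ) := by
      rw [hm]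
      push_cast
      ring
    rw [h4, hgm, g.toFun_add_int]

end HamPi1

/-! ### Loops following the orbits of the skew product -/

theorem UnitAddCircle.continuous_of_comp_coe {M Z : Type*} [TopologicalSpace M]
    [TopologicalSpace Z] {f : UnitAddCircle × M → Z}
    (hf : Continuous fun p : ℝ × M => f ((p.1 : UnitAddCircle), p.2)) : Continuous f := by
  have hq : IsOpenQuotientMap (Prod.map ((↑) : ℝ → UnitAddCircle) (id : M → M)) :=
    QuotientAddGroup.isOpenQuotientMap_mk.prodMap IsOpenQuotientMap.id
  exact hq.isQuotientMap.continuous_iff.2 hf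

namespace HamLoop

variable {n : ℕ} {M : Type*} [TopologicalSpace M] [ChartedSpace (R2n n) M]
  [MeasurableSpace M] {Ω : SymplecticForm n M}

theorem skewProduct_coe (h : HamLoop Ω) (α t : ℝ) (y : M) :
    h.skewProduct α ((t : UnitAddCircle), y) = (((t + α : ℝ) : UnitAddCircle), h.toFun t y) := rfl

theorem continuous_skewProduct (h : HamLoop Ω) (α : ℝ) : Continuous (h.skewProduct α) := by
  refine UnitAddCircle.continuous_of_comp_coe ?_
  simp only [skewProduct_coe]
  exact ((AddCircle.continuous_mk' 1).comp (continuous_fst.add continuous_const)).prodMk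
    h.smooth.1.continuous

/-- The value of the Hamiltonian of a loop at the image point, a function on `S¹ × M`. -/
def hamiltonianAtImage (h : HamLoop Ω) {H : ℝ → M → ℝ} (hH : Function.Periodic H 1)
    (p : UnitAddCircle × M) : ℝ :=
  hH.lift p.1 (h.periodic.lift p.1 p.2)

theorem hamiltonianAtImage_coe (h : HamLoop Ω) {H : ℝ → M → ℝ} (hH : Function.Periodic H 1)
    (t : ℝ) (y : M) :
    h.hamiltonianAtImage hH ((t : UnitAddCircle), y) = H t (h.toFun t y) := rfl

theorem continuous_hamiltonianAtImage (h : HamLoop Ω) {H : ℝ → M → ℝ}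
    (hH : Ω.IsNormalizedHamiltonian H h.toFun) : Continuous (h.hamiltonianAtImage hH.2.1) := by
  refine UnitAddCircle.continuous_of_comp_coe ?_
  simp only [hamiltonianAtImage_coe]
  exact hH.1.1.continuous.comp (continuous_fst.prodMk h.smooth.1.continuous)

/-- The loop precomposed with a rotation of the circle. -/
def shift (h : HamLoop Ω) (a : ℝ) : HamLoop Ω :=
  h.reparam (fun t => t + a) (contDiff_id.add contDiff_const) 1 (fun t => by push_cast; ring)

/-- A loop has length at most any uniform bound for its normalized Hamiltonian. -/
theorem exists_hasLength_le (h : HamLoop Ω) {H : ℝ → M → ℝ}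
    (hH : Ω.IsNormalizedHamiltonian H h.toFun) {C : ℝ} (hC : 0 ≤ C) (hb : ∀ t y, |H t y| ≤ C) :
    ∃ ℓ ≤ C, h.HasLength ℓ := by
  refine ⟨_, ?_, H, hH, rfl⟩
  refine (le_abs_self _).trans ?_
  have := intervalIntegral.norm_integral_le_of_norm_le_const (a := 0) (b := 1) (C := C)
    (f := fun t => ⨆ y, |H t y|) fun t _ => ?_
  · simpa using this
  · rw [Real.norm_of_nonneg (Real.iSup_nonneg fun y => abs_nonneg _)]
    exact Real.iSup_le (hb t) hC

variable [BorelSpace M] [IsManifold 𝓘(ℝ, R2n n) ∞ M] [SecondCountableTopology M] [CompactSpace M]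

/-- The loop `t ↦ h (t + (k - 1) α) ∘ ⋯ ∘ h (t + α) ∘ h t`, whose value at `t` is the fibre part of
the `k`-th iterate of the skew product. -/
def orbitProduct (h : HamLoop Ω) (α : ℝ) : ℕ → HamLoop Ω
  | 0 => .const _ (SymplecticForm.id_mem_ham Ω)
  | k + 1 => (h.shift (k * α)).mul (h.orbitProduct α k)

theorem iterate_skewProduct (h : HamLoop Ω) (α : ℝ) (k : ℕ) (t : ℝ) (y : M) :
    (h.skewProduct α)^[k] ((t : UnitAddCircle), y) =
      (((t + k * α : ℝ) : UnitAddCircle), (h.orbitProduct α k).toFun t y) := by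
  induction k with
  | zero => simp [orbitProduct, const]
  | succ k ih =>
    rw [Function.iterate_succ_apply', ih, skewProduct_coe]
    have : t + k * α + α = t + ((k + 1 : ℕ) : ℝ) * α := by push_cast; ring
    rw [this]
    rfl

/-- The normalized Hamiltonian of `orbitProduct`, evaluated at the image of a point, is a Birkhoff
sum of the skew product. -/
theorem exists_hamiltonian_orbitProduct (h : HamLoop Ω) (α : ℝ) {H : ℝ → M → ℝ}
    (hH : Ω.IsNormalizedHamiltonian H h.toFun) (k : ℕ) :
    ∃ K : ℝ → M → ℝ, Ω.IsNormalizedHamiltonian K (h.orbitProduct α k).toFun ∧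
      ∀ t y, K t ((h.orbitProduct α k).toFun t y) =
        birkhoffSum (h.skewProduct α) (h.hamiltonianAtImage hH.2.1) k
          ((t : UnitAddCircle), y) := by
  induction k with
  | zero =>
    exact ⟨fun _ _ => 0, ⟨Ω.generates_const _, fun _ => rfl, fun _ => by simp⟩, fun t y => by simp⟩
  | succ k ih =>
    obtain ⟨K, hK, hKsum⟩ := ih
    have hτ : ContDiff ℝ ∞ (fun t : ℝ => t + k * α) := contDiff_id.add contDiff_const
    have hs : Ω.IsNormalizedHamiltonian (fun t => H (t + k * α)) (h.shift (k * α)).toFun := by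
      have h1 := hH.reparam h.smooth hτ (m := 1) (fun t => by push_cast; ring)
      simp only [deriv_add_const, deriv_id'', one_mul] at h1
      exact h1
    refine ⟨_, hK.trans (h.orbitProduct α k).smooth (h.shift (k * α)).smooth hs
      (fun t => ((h.shift _).mem_ham t).1) (h.shift _).periodic, fun t y => ?_⟩
    rw [birkhoffSum_succ, ← hKsum, iterate_skewProduct, hamiltonianAtImage_coe, add_comm]
    congr 2
    exact ((h.shift (k * α)).toFun t).symm_apply_apply _

end HamLoop

namespace HamPi1

variable {n : ℕ} {M : Type*} [TopologicalSpace M] [ChartedSpace (R2n n) M]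
  [MeasurableSpace M] {Ω : SymplecticForm n M}

theorem nonneg_of_hasLength {h : HamLoop Ω} {ℓ : ℝ} (hℓ : h.HasLength ℓ) : 0 ≤ ℓ := by
  obtain ⟨H, -, rfl⟩ := hℓ
  exact intervalIntegral.integral_nonneg zero_le_one fun t _ =>
    Real.iSup_nonneg fun y => abs_nonneg _

theorem hoferNorm_nonneg (γ : HamPi1 Ω) : 0 ≤ γ.hoferNorm :=
  Real.sInf_nonneg fun _ ⟨_, _, hℓ⟩ => nonneg_of_hasLength hℓ

theorem hoferNorm_mk_le {h : HamLoop Ω} {ℓ : ℝ} (hℓ : h.HasLength ℓ) : (mk h).hoferNorm ≤ ℓ :=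
  csInf_le ⟨0, fun _ ⟨_, _, hℓ⟩ => nonneg_of_hasLength hℓ⟩ ⟨h, rfl, hℓ⟩

variable [BorelSpace M] [IsManifold 𝓘(ℝ, R2n n) ∞ M] [SecondCountableTopology M] [CompactSpace M]

/-- Deforming the shifts to zero turns `orbitProduct` into the pointwise power of `h`, which is
homotopic to the iterate of `h`. -/
theorem mk_orbitProduct (h : HamLoop Ω) (α : ℝ) (k : ℕ) :
    mk (h.orbitProduct α k) = (mk h).npow k := by
  obtain ⟨g, hg0, hgh⟩ := exists_mk_eq_based h
  rw [← hgh, npow_mk]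
  induction k with
  | zero =>
    congr 1
    refine HamLoop.ext_apply fun t y => ?_
    simp [HamLoop.orbitProduct, HamLoop.const, HamLoop.iterate, hg0]
  | succ k ih =>
    have hshift : mk (h.shift (k * α)) = mk h :=
      (mk_eq_of_smoothHomotopic (h.smoothHomotopic_reparam contDiff_id _
        (fun t => by push_cast; rfl) _)).symm
    rw [HamLoop.orbitProduct, ← mul_mk, ih, hshift, ← hgh, mk_mul_mk_iterate g hg0]

end HamPi1

/-! ### The invariant measure of the skew product -/

section InvariantMeasure

variable {n : ℕ} {M : Type*} [TopologicalSpace M] [ChartedSpace (R2n n) M]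
  [MeasurableSpace M] {Ω : SymplecticForm n M}

/-- The symplectic volume measure, normalized to a probability measure. -/
def SymplecticForm.probabilityVolume (Ω : SymplecticForm n M) : Measure M :=
  (Ω.volumeMeasure Set.univ)⁻¹ • Ω.volumeMeasure

variable [BorelSpace M] [IsManifold 𝓘(ℝ, R2n n) ∞ M] [SecondCountableTopology M] [CompactSpace M]

theorem SymplecticForm.isProbabilityMeasure_probabilityVolume [Nonempty M]
    (Ω : SymplecticForm n M) :
    IsProbabilityMeasure Ω.probabilityVolume := by
  have := Ω.isFiniteMeasure_volumeMeasure
  have : NeZero Ω.volumeMeasure := ⟨Ω.volumeMeasure_ne_zero⟩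
  exact isProbabilityMeasureSMul

/-- The product of Haar measure and symplectic volume is invariant under the skew product. -/
theorem HamLoop.measurePreserving_skewProduct [Nonempty M] (h : HamLoop Ω) (α : ℝ) :
    MeasurePreserving (h.skewProduct α)
      ((volume : Measure UnitAddCircle).prod Ω.probabilityVolume)
      ((volume : Measure UnitAddCircle).prod Ω.probabilityVolume) := by
  have := Ω.isProbabilityMeasure_probabilityVolume
  refine (measurePreserving_add_right volume (α : UnitAddCircle)).skew_product
    (g := fun a y => h.periodic.lift a y)
    (measurable_snd.comp (h.continuous_skewProduct α).measurable) (.of_forall fun a => ?_)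
  induction a using QuotientAddGroup.induction_on with
  | H t =>
    have h1 := ((h.mem_ham t).1.measurePreserving.smul_measure
      (Ω.volumeMeasure Set.univ)⁻¹).map_eq
    exact h1

/-- The function `(t, y) ↦ H t (h t y)` has mean zero, as each `h t` preserves the volume and `H` is
normalized. -/
theorem HamLoop.integral_hamiltonianAtImage [Nonempty M] (h : HamLoop Ω) {H : ℝ → M → ℝ}
    (hH : Ω.IsNormalizedHamiltonian H h.toFun) :
    ∫ p, h.hamiltonianAtImage hH.2.1 p
      ∂((volume : Measure UnitAddCircle).prod Ω.probabilityVolume) = 0 := by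
  have := Ω.isProbabilityMeasure_probabilityVolume
  rw [integral_prod _ ((h.continuous_hamiltonianAtImage hH).integrable_of_hasCompactSupport
    (.of_compactSpace _))]
  refine integral_eq_zero_of_ae (.of_forall fun a => ?_)
  induction a using QuotientAddGroup.induction_on with
  | H t =>
    have h1 := (h.mem_ham t).1.measurePreserving.integral_comp
      (h.toFun t).toHomeomorph.isClosedEmbedding.measurableEmbedding (H t)
    rw [hH.2.2] at h1
    change ∫ y, H t (h.toFun t y) ∂Ω.probabilityVolume = 0
    rw [SymplecticForm.probabilityVolume, integral_smul_measure, h1, smul_zero]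

end InvariantMeasure

end

/-! ### The asymptotic Hofer norm -/

theorem theorem1p3 {n : ℕ} {M : Type*} [TopologicalSpace M] [T2Space M] [CompactSpace M]
    [ConnectedSpace M] [ChartedSpace (R2n n) M] [IsManifold 𝓘(ℝ, R2n n) ∞ M]
    [MeasurableSpace M] [BorelSpace M] (Ω : SymplecticForm n M) (γ : HamPi1 Ω)
    (hγ : ∃ h : HamLoop Ω, γ.IsRepresentedBy h ∧ h.IsStrictlyErgodic) :
    Filter.Tendsto (fun k : ℕ => (γ.npow k).hoferNorm / (k : ℝ)) Filter.atTop (𝓝 0) := by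
  have : SecondCountableTopology M := ChartedSpace.secondCountable_of_sigmaCompact (R2n n) M
  have : TopologicalSpace.MetrizableSpace M :=
    TopologicalSpace.metrizableSpace_of_t3_secondCountable M
  obtain ⟨h, rfl, α, -, μ, -, -, huniq, -⟩ := hγ
  obtain ⟨H, hH⟩ := h.exists_hamiltonian
  have := Ω.isProbabilityMeasure_probabilityVolume
  have : IsProbabilityMeasure (volume : Measure UnitAddCircle) := ⟨UnitAddCircle.measure_univ⟩
  have hμ := huniq _ inferInstance (h.measurePreserving_skewProduct α)
  have hmean := h.integral_hamiltonianAtImage hH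
  rw [hμ] at hmean
  rw [Metric.tendsto_atTop]
  intro ε hε
  obtain ⟨N, hN⟩ := exists_forall_abs_birkhoffSum_le (h.continuous_skewProduct α) huniq
    (h.continuous_hamiltonianAtImage hH) hmean (half_pos hε)
  refine ⟨N, fun k hk => ?_⟩
  obtain ⟨K, hK, hKsum⟩ := h.exists_hamiltonian_orbitProduct α hH k
  obtain ⟨ℓ, hℓ, hlen⟩ := (h.orbitProduct α k).exists_hasLength_le hK (C := ε / 2 * k)
    (by positivity) fun t y => by
      have := hKsum t (((h.orbitProduct α k).toFun t).symm y)
      rw [Diffeomorph.apply_symm_apply] at this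
      rw [this]
      exact hN k hk _
  have hle := HamPi1.hoferNorm_mk_le hlen
  rw [HamPi1.mk_orbitProduct] at hle
  have h0 := HamPi1.hoferNorm_nonneg ((HamPi1.mk h).npow k)
  change dist (((HamPi1.mk h).npow k).hoferNorm / k) 0 < ε
  rw [Real.dist_0_eq_abs, abs_of_nonneg (by positivity)]
  refine lt_of_le_of_lt (div_le_of_le_mul₀ (by positivity) (by positivity) (hle.trans hℓ)) ?_
  linarith
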